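/- Let $n\ge 2$. For a multi-index $\alpha\in(\mathbb{N}\cup\{0\})^n$ put $|\alpha|=\alpha_1+\dots+\alpha_n$, $\alpha!=\alpha_1!\cdots\alpha_n!$, and let $$h_\alpha(x)=\frac{(-1)^{|\alpha|}}{\pi^{n/4}2^{|\alpha|/2}\alpha!^{1/2}}\,e^{|x|^2/2}\Bigl(\frac{\partial}{\partial x}\Bigr)^{\alpha}e^{-|x|^2},\qquad x\in\mathbb{R}^n,$$ be the Hermite functions. Let $K:\mathbb{R}^n\setminus\{0\}\to\mathbb{C}$ be smooth, homogeneous of degree $0$ (that is, $K(rx)=K(x)$ for $r>0$), and such that $\int_{\mathbb{S}^{n-1}}K(\omega)\,d\sigma(\omega)=0$, where $\sigma$ is the surface measure on the unit sphere $\mathbb{S}^{n-1}$. Put $$M(n,K,\alpha)=\int_{\mathbb{S}^{n-1}}\omega^{\alpha}K(\omega)\,d\sigma(\omega).$$ Then for every Schwartz function $\phi\in\mathscr{S}(\mathbb{R}^n)$ the limit $$\Bigl\langle \operatorname{vp}\frac{K(x)}{|x|^n},\phi\Bigr\rangle=\lim_{\varepsilon\downarrow 0}\int_{|x|>\varepsilon}\frac{K(x)}{|x|^n}\phi(x)\,dx$$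 of absolutely convergent integrals exists, and it defines a tempered distribution $\operatorname{vp}K(x)/|x|^n$. This distribution has exactly one Hermite expansion $$\operatorname{vp}\frac{K(x)}{|x|^n}=\sum_{\alpha}a_\alpha h_\alpha\quad\text{in }\mathscr{S}'(\mathbb{R}^n)$$ with complex coefficients (an unconditionally convergent sum over all multi-indices, tested against each Schwartz function), and its coefficients are $a_0=0$ and, for every $\alpha\neq 0$, $$a_\alpha=\pi^{-n/4}\,2^{|\alpha|-1}\,\alpha!^{1/2}\sum_{\gamma<\alpha/2}\frac{\Gamma\bigl(\frac{|\alpha-2\gamma|}{2}\bigr)}{\gamma!\,(\alpha-2\gamma)!}\cdot\frac{(-1)^{|\gamma|}}{2^{3|\gamma|}}\cdot M(n,K,\alpha-2\gamma),$$ where $\gamma<\alpha/2$ means that $\gamma\in(\mathbb{N}\cup\{0\})^n$, $2\gamma_i\le\alpha_i$ for all $i$, and $2\gamma\ne\alpha$. -/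

import Mathlib

open MeasureTheory Filter Topology
open scoped SchwartzMap ContDiff Nat

namespace HermiteExpansion

/-- The order `|α| = α₁ + ⋯ + αₙ` of a multi-index. -/
def order {n : ℕ} (α : Fin n → ℕ) : ℕ := ∑ i, α i

/-- The factorial `α! = α₁! ⋯ αₙ!` of a multi-index. -/
def factorial {n : ℕ} (α : Fin n → ℕ) : ℕ := ∏ i, (α i)!

/-- The first order partial derivative `∂f/∂xᵢ`. -/
noncomputable def partialDeriv {n : ℕ} (i : Fin n) (f : EuclideanSpace ℝ (Fin n) → ℝ) :
    EuclideanSpace ℝ (Fin n) → ℝ :=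
  fun x => lineDeriv ℝ f x (EuclideanSpace.single i 1)

/-- The iterated partial derivative `(∂/∂x)^α f = ∂₁^α₁ (∂₂^α₂ (⋯ (∂ₙ^αₙ f)))`. -/
noncomputable def iteratedPartialDeriv {n : ℕ} (α : Fin n → ℕ)
    (f : EuclideanSpace ℝ (Fin n) → ℝ) : EuclideanSpace ℝ (Fin n) → ℝ :=
  (List.finRange n).foldr (fun i g => (partialDeriv i)^[α i] g) f

/-- The Hermite function
`h_α(x) = (-1)^|α| π^(-n/4) 2^(-|α|/2) (α!)^(-1/2) e^(|x|²/2) (∂/∂x)^α e^(-|x|²)`. -/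
noncomputable def hermiteFun {n : ℕ} (α : Fin n → ℕ) (x : EuclideanSpace ℝ (Fin n)) : ℝ :=
  (-1) ^ order α /
      (Real.pi ^ ((n : ℝ) / 4) * 2 ^ ((order α : ℝ) / 2) * Real.sqrt (factorial α)) *
    Real.exp (‖x‖ ^ 2 / 2) *
    iteratedPartialDeriv α (fun y => Real.exp (-‖y‖ ^ 2)) x

/-- `T = ∑_α a_α h_α` in the space of tempered distributions: the series, with `h_α` acting on
test functions by integration, converges to `T` when tested against any Schwartz function. -/
def HasHermiteExpansion {n : ℕ} (T : 𝓢'(EuclideanSpace ℝ (Fin n), ℂ))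
    (a : (Fin n → ℕ) → ℂ) : Prop :=
  ∀ f : 𝓢(EuclideanSpace ℝ (Fin n), ℂ),
    HasSum (fun α => a α * ∫ x, (hermiteFun α x : ℂ) * f x) (T f)

/-- The spherical moment `M(n,K,α) = ∫_{S^{n-1}} ω^α K(ω) dσ(ω)`; `volume.toSphere` is the
standard surface measure on the unit sphere, the one of integration in polar coordinates. -/
noncomputable def sphereMoment (n : ℕ) (K : EuclideanSpace ℝ (Fin n) → ℂ) (α : Fin n → ℕ) : ℂ :=
  ∫ u : Metric.sphere (0 : EuclideanSpace ℝ (Fin n)) 1,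
    ((∏ i, (u : EuclideanSpace ℝ (Fin n)) i ^ α i : ℝ) : ℂ) * K u
    ∂(volume : Measure (EuclideanSpace ℝ (Fin n))).toSphere

/-- The tempered distribution `T` is the principal value `vp K(x)/|x|ⁿ`: for every Schwartz
function `f`, the truncated integrals converge absolutely and tend to `T f`. -/
def IsPrincipalValue {n : ℕ} (K : EuclideanSpace ℝ (Fin n) → ℂ)
    (T : 𝓢'(EuclideanSpace ℝ (Fin n), ℂ)) : Prop :=
  ∀ f : 𝓢(EuclideanSpace ℝ (Fin n), ℂ),
    (∀ ε > (0 : ℝ), IntegrableOn (fun x => K x / (‖x‖ : ℂ) ^ n * f x) {x | ε < ‖x‖}) ∧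
    Tendsto (fun ε : ℝ => ∫ x in {x | ε < ‖x‖}, K x / (‖x‖ : ℂ) ^ n * f x) (𝓝[>] 0) (𝓝 (T f))

end HermiteExpansion

/-! The `h_α` are orthonormal, so testing an expansion of `T` against `h_β` leaves only `a_β =
T(h_β)`. Hence uniqueness is immediate, and what remains is to show that `T` acts termwise on
Hermite series and to compute `T(h_β)`.

Since `K` has mean zero on the sphere, its singular kernel integrates every radial function to zero
(`IsMeanZeroKernel.integral_mul_radial`). So `f(0)` may be subtracted on the unit ball, and the
principal value becomes an absolutely convergent integral dominated by `min(|x|, 1/|x|) / |x|ⁿ`. It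
is controlled by a Lipschitz bound for `f` and a bound for `|x| |f(x)|`.

For `h_α` these two bounds grow polynomially in `α`, by the ladder relations, while the Hermite
coefficients of a Schwartz function decay faster than any polynomial: the product of raising and
lowering operators maps Schwartz functions to themselves and multiplies coefficients by `2(α_i +
1)`. The Hermite series of `f` therefore converges uniformly, and to `f`, because a bounded
continuous function orthogonal to all `h_α` vanishes (`eq_zero_of_hermiteCoef_eq_zero`). The same
summability allows `T` to be applied term by term
(`IsMeanZeroKernel.hasSum_hermiteCoef_mul_pvIntegral`).

Finally, the explicit Hermite polynomials write `h_α` as a combination of `x^(α-2γ) e^(-|x|²/2)`. In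
polar coordinates each such function gives a spherical moment times a Gamma integral. The term with
`2γ = α` is radial and contributes zero, which is why it is missing from the formula. -/

namespace HermiteExpansion

/-! ### Hermite polynomials: recurrences and orthogonality -/

open Polynomial in
/-- The physicists' Hermite polynomials. -/
noncomputable def hermitePoly : ℕ → ℝ[X]
  | 0 => 1
  | k + 1 => 2 * X * hermitePoly k - derivative (hermitePoly k)

open Polynomial in
theorem derivative_hermitePoly_succ (k : ℕ) :
    derivative (hermitePoly (k + 1)) = 2 * ((k : ℝ[X]) + 1) * hermitePoly k := by
  induction k with
  | zero => simp [hermitePoly]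
  | succ k ih =>
    rw [hermitePoly, derivative_sub, ih]
    have h2 : derivative (2 * (X : ℝ[X])) = 2 := by
      rw [derivative_mul]; simp
    have h3 : derivative (2 * ((k : ℝ[X]) + 1) * hermitePoly k)
        = 2 * ((k : ℝ[X]) + 1) * derivative (hermitePoly k) := by
      rw [derivative_mul]; simp
    rw [derivative_mul, ih, h2, h3]
    conv_lhs => enter [1, 1]; rw [hermitePoly]
    rw [hermitePoly]
    push_cast
    ring

-- The truncated index `k - 1` is harmless at `k = 0` because its coefficient vanishes there; the
-- ladder relations below rely on the same convention.
open Polynomial in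
theorem derivative_hermitePoly (k : ℕ) :
    derivative (hermitePoly k) = 2 * (k : ℝ[X]) * hermitePoly (k - 1) := by
  cases k with
  | zero => simp [hermitePoly]
  | succ k => simp [derivative_hermitePoly_succ]

theorem eval_hermitePoly_succ (k : ℕ) (t : ℝ) :
    (hermitePoly (k + 1)).eval t =
      2 * t * (hermitePoly k).eval t - 2 * k * (hermitePoly (k - 1)).eval t := by
  rw [hermitePoly, derivative_hermitePoly]
  simp

theorem hasDerivAt_exp_neg_sq (t : ℝ) :
    HasDerivAt (fun t : ℝ => Real.exp (-t ^ 2)) (-(2 * t) * Real.exp (-t ^ 2)) t := by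
  have := ((hasDerivAt_pow 2 t).fun_neg).exp
  refine this.congr_deriv ?_
  push_cast
  ring

theorem hasDerivAt_exp_neg_sq_half (t : ℝ) :
    HasDerivAt (fun t : ℝ => Real.exp (-t ^ 2 / 2)) (-t * Real.exp (-t ^ 2 / 2)) t := by
  have := (((hasDerivAt_pow 2 t).fun_neg).div_const 2).exp
  refine this.congr_deriv ?_
  push_cast
  ring

theorem hasDerivAt_hermitePoly_mul_exp (k : ℕ) (t : ℝ) :
    HasDerivAt (fun t => (hermitePoly k).eval t * Real.exp (-t ^ 2))
      (-((hermitePoly (k + 1)).eval t * Real.exp (-t ^ 2))) t := by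
  refine (((hermitePoly k).hasDerivAt t).fun_mul (hasDerivAt_exp_neg_sq t)).congr_deriv ?_
  simp only [hermitePoly, Polynomial.eval_sub, Polynomial.eval_mul, Polynomial.eval_ofNat,
    Polynomial.eval_X]
  ring

theorem iterate_deriv_exp_neg_sq (k : ℕ) :
    deriv^[k] (fun t : ℝ => Real.exp (-t ^ 2)) =
      fun t => (-1) ^ k * ((hermitePoly k).eval t * Real.exp (-t ^ 2)) := by
  induction k with
  | zero => simp [hermitePoly]
  | succ k ih =>
    rw [Function.iterate_succ_apply', ih]
    funext t
    rw [((hasDerivAt_hermitePoly_mul_exp k t).const_mul _).deriv]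
    ring

theorem integrable_pow_mul_exp_neg_sq (j : ℕ) :
    Integrable fun t : ℝ => t ^ j * Real.exp (-t ^ 2) := by
  have := integrable_rpow_mul_exp_neg_mul_sq (b := 1) one_pos (s := (j : ℝ))
    (by have : (0 : ℝ) ≤ j := j.cast_nonneg
        linarith)
  simpa using this

theorem integrable_eval_mul_exp_neg_sq (p : Polynomial ℝ) :
    Integrable fun t : ℝ => p.eval t * Real.exp (-t ^ 2) := by
  simp_rw [Polynomial.eval_eq_sum_range, Finset.sum_mul, mul_assoc]
  exact integrable_finsetSum _ fun j _ => (integrable_pow_mul_exp_neg_sq j).const_mul _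

/-- Integration by parts: `H_{k+1} e^{-t²}` is minus the derivative of `H_k e^{-t²}`, so one
derivative moves onto `p`. -/
theorem integral_hermitePoly_succ_mul (k : ℕ) (p : Polynomial ℝ) :
    ∫ t : ℝ, (hermitePoly (k + 1)).eval t * p.eval t * Real.exp (-t ^ 2) =
      ∫ t : ℝ, (hermitePoly k).eval t * p.derivative.eval t * Real.exp (-t ^ 2) := by
  have hd : ∀ t : ℝ, HasDerivAt (fun t => (hermitePoly k * p).eval t * Real.exp (-t ^ 2))
      ((hermitePoly k * p.derivative).eval t * Real.exp (-t ^ 2) -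
        (hermitePoly (k + 1) * p).eval t * Real.exp (-t ^ 2)) t := by
    intro t
    have h := (hasDerivAt_hermitePoly_mul_exp k t).fun_mul (p.hasDerivAt t)
    have he : (fun t => (hermitePoly k * p).eval t * Real.exp (-t ^ 2)) =
        fun t => (hermitePoly k).eval t * Real.exp (-t ^ 2) * p.eval t := by
      funext s
      rw [Polynomial.eval_mul]
      ring
    rw [he]
    refine h.congr_deriv ?_
    simp only [Polynomial.eval_mul]
    ring
  have h := integral_eq_zero_of_hasDerivAt_of_integrable hd
    ((integrable_eval_mul_exp_neg_sq _).sub (integrable_eval_mul_exp_neg_sq _))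
    (integrable_eval_mul_exp_neg_sq _)
  rw [integral_sub (integrable_eval_mul_exp_neg_sq _) (integrable_eval_mul_exp_neg_sq _)] at h
  simp only [Polynomial.eval_mul] at h
  linarith

/-- Each integration by parts lowers both indices by one, at the cost of a factor `2(m + 1)`, until
one index is zero. -/
theorem integral_hermitePoly_mul_hermitePoly (k m : ℕ) :
    ∫ t : ℝ, (hermitePoly k).eval t * (hermitePoly m).eval t * Real.exp (-t ^ 2) =
      if k = m then √Real.pi * 2 ^ k * k ! else 0 := by
  induction k generalizing m with
  | zero =>
    cases m with
    | zero =>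
      have := integral_gaussian 1
      simpa [hermitePoly] using this
    | succ m =>
      have := integral_hermitePoly_succ_mul m 1
      simp only [Polynomial.eval_one, mul_one, Polynomial.derivative_one, Polynomial.eval_zero,
        mul_zero, zero_mul, integral_zero] at this
      simpa [hermitePoly] using this
  | succ k ih =>
    rw [integral_hermitePoly_succ_mul]
    cases m with
    | zero => simp [hermitePoly]
    | succ m =>
      have h (t : ℝ) : (hermitePoly k).eval t * (hermitePoly (m + 1)).derivative.eval t *
          Real.exp (-t ^ 2) = (2 * ((m : ℝ) + 1)) *
          ((hermitePoly k).eval t * (hermitePoly m).eval t * Real.exp (-t ^ 2)) := by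
        rw [derivative_hermitePoly_succ]; simp; ring
      simp_rw [h, integral_const_mul, ih]
      by_cases hkm : k = m
      · subst hkm
        simp [Nat.factorial_succ]; ring
      · simp [hkm]

/-! ### Hermite functions on the line: ladder relations and bounds -/

/-- The normalizing constant of the `k`-th Hermite function on the line. -/
noncomputable def hermiteConst (k : ℕ) : ℝ := (√(√Real.pi * 2 ^ k * k !))⁻¹

theorem hermiteConst_pos (k : ℕ) : 0 < hermiteConst k := by
  have := Real.pi_pos
  unfold hermiteConst
  positivity

theorem hermiteConst_succ (k : ℕ) :
    hermiteConst k = √(2 * (k + 1)) * hermiteConst (k + 1) := by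
  have h : √Real.pi * 2 ^ (k + 1) * ((k + 1)! : ℝ) =
      (2 * (k + 1)) * (√Real.pi * 2 ^ k * k !) := by
    rw [Nat.factorial_succ]; push_cast; ring
  unfold hermiteConst
  have h0 : (0 : ℝ) ≤ 2 * (k + 1) := by positivity
  have h1 : √(2 * ((k : ℝ) + 1)) ≠ 0 := by positivity
  rw [h, Real.sqrt_mul h0, mul_inv, ← mul_assoc, mul_inv_cancel₀ h1, one_mul]

theorem sqrt_mul_hermiteConst_pred (k : ℕ) :
    √(k / 2) * hermiteConst (k - 1) = k * hermiteConst k := by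
  cases k with
  | zero => simp
  | succ k =>
    rw [Nat.add_sub_cancel, hermiteConst_succ k, ← mul_assoc, ← Real.sqrt_mul (by positivity)]
    push_cast
    rw [show ((k : ℝ) + 1) / 2 * (2 * (k + 1)) = (k + 1) ^ 2 by ring,
      Real.sqrt_sq (by positivity)]

/-- The `k`-th Hermite function on the line. -/
noncomputable def hermiteLine (k : ℕ) (t : ℝ) : ℝ :=
  hermiteConst k * (hermitePoly k).eval t * Real.exp (-t ^ 2 / 2)

/-- The normalized three-term recurrence. Multiplication by `t` is the sum of a lowering and a
raising term; the derivative below is the difference of the same two terms. -/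
theorem mul_hermiteLine (k : ℕ) (t : ℝ) :
    t * hermiteLine k t =
      √(k / 2) * hermiteLine (k - 1) t + √((k + 1) / 2) * hermiteLine (k + 1) t := by
  have h1 := eval_hermitePoly_succ k t
  have h2 : hermiteConst k = 2 * √((k + 1) / 2) * hermiteConst (k + 1) := by
    rw [hermiteConst_succ, show (2 : ℝ) * (k + 1) = 2 ^ 2 * ((k + 1) / 2) by ring,
      Real.sqrt_mul (by positivity), Real.sqrt_sq (by norm_num)]
  have h3 := sqrt_mul_hermiteConst_pred k
  unfold hermiteLine
  rw [h1]
  linear_combination (-(hermitePoly (k-1)).eval t * Real.exp (-t ^ 2 / 2)) * h3 +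
    (t * (hermitePoly k).eval t - k * (hermitePoly (k - 1)).eval t) *
      Real.exp (-t ^ 2 / 2) * h2

theorem hasDerivAt_hermiteLine (k : ℕ) (t : ℝ) :
    HasDerivAt (hermiteLine k)
      (√(k / 2) * hermiteLine (k - 1) t - √((k + 1) / 2) * hermiteLine (k + 1) t) t := by
  have h := (((hermitePoly k).hasDerivAt t).const_mul (hermiteConst k)).mul
    (hasDerivAt_exp_neg_sq_half t)
  have h3 := sqrt_mul_hermiteConst_pred k
  refine h.congr_deriv ?_
  have h4 := mul_hermiteLine k t
  rw [derivative_hermitePoly]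
  simp only [hermiteLine, Polynomial.eval_mul, Polynomial.eval_natCast,
    Polynomial.eval_ofNat] at h4 ⊢
  linear_combination (-2 * (hermitePoly (k-1)).eval t * Real.exp (-t ^ 2 / 2)) * h3 - h4

theorem hermiteLine_mul (k m : ℕ) (t : ℝ) : hermiteLine k t * hermiteLine m t =
    hermiteConst k * hermiteConst m *
      ((hermitePoly k * hermitePoly m).eval t * Real.exp (-t ^ 2)) := by
  have : Real.exp (-t ^ 2) = Real.exp (-t ^ 2 / 2) * Real.exp (-t ^ 2 / 2) := by
    rw [← Real.exp_add]; ring_nf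
  rw [this, Polynomial.eval_mul]
  unfold hermiteLine
  ring

theorem integrable_hermiteLine_mul (k m : ℕ) :
    Integrable fun t => hermiteLine k t * hermiteLine m t := by
  simp_rw [hermiteLine_mul]
  exact (integrable_eval_mul_exp_neg_sq _).const_mul _

theorem integral_hermiteLine_mul (k m : ℕ) :
    ∫ t, hermiteLine k t * hermiteLine m t = if k = m then 1 else 0 := by
  simp_rw [hermiteLine_mul, integral_const_mul, Polynomial.eval_mul,
    integral_hermitePoly_mul_hermitePoly]
  split_ifs with h
  · subst h
    have hp := Real.pi_pos
    have : (0 : ℝ) < √Real.pi * 2 ^ k * k ! := by positivity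
    rw [hermiteConst, ← mul_inv, Real.mul_self_sqrt this.le, inv_mul_cancel₀ this.ne']
  · simp

theorem continuous_hermiteLine (k : ℕ) : Continuous (hermiteLine k) :=
  continuous_iff_continuousAt.2 fun t => (hasDerivAt_hermiteLine k t).continuousAt

/-- A one-dimensional Sobolev estimate: `h²` is the integral of `2hh' ≤ h² + h'²` from `-∞`, and by
the ladder relation and orthonormality the total is `1 + (k + 1/2)`. -/
theorem sq_hermiteLine_le (k : ℕ) (t : ℝ) : hermiteLine k t ^ 2 ≤ 2 * k + 2 := by
  set d : ℝ → ℝ := fun t =>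
    √(k / 2) * hermiteLine (k - 1) t - √((k + 1) / 2) * hermiteLine (k + 1) t with hd
  have hda : ∀ t, HasDerivAt (fun t => hermiteLine k t * hermiteLine k t)
      (d t * hermiteLine k t + hermiteLine k t * d t) t := fun t =>
    (hasDerivAt_hermiteLine k t).mul (hasDerivAt_hermiteLine k t)
  have hdd : ∀ t, d t * d t = k / 2 * (hermiteLine (k - 1) t * hermiteLine (k - 1) t) +
      (k + 1) / 2 * (hermiteLine (k + 1) t * hermiteLine (k + 1) t) -
      2 * (√(k / 2) * √((k + 1) / 2)) * (hermiteLine (k - 1) t * hermiteLine (k + 1) t) := by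
    intro t
    have e1 := Real.mul_self_sqrt (show (0 : ℝ) ≤ k / 2 by positivity)
    have e2 := Real.mul_self_sqrt (show (0 : ℝ) ≤ (k + 1) / 2 by positivity)
    simp only [hd]
    linear_combination (hermiteLine (k - 1) t * hermiteLine (k - 1) t) * e1 +
      (hermiteLine (k + 1) t * hermiteLine (k + 1) t) * e2
  have hi1 := (integrable_hermiteLine_mul (k-1) (k-1)).const_mul ((k : ℝ) / 2)
  have hi2 := (integrable_hermiteLine_mul (k+1) (k+1)).const_mul (((k : ℝ) + 1) / 2)
  have hi3 := (integrable_hermiteLine_mul (k-1) (k+1)).const_mul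
    (2 * (√((k : ℝ) / 2) * √((k + 1) / 2)))
  have hid : Integrable fun t => d t * d t := by
    simp_rw [hdd]
    exact (hi1.add hi2).sub hi3
  have hIdd : ∫ t, d t * d t = k / 2 + (k + 1) / 2 := by
    simp_rw [hdd]
    rw [integral_sub (by exact hi1.add hi2) hi3, integral_add hi1 hi2]
    simp_rw [integral_const_mul, integral_hermiteLine_mul]
    -- The cross term vanishes by orthogonality, also when `k = 0` and `k - 1` truncates.
    rw [if_neg (show k - 1 ≠ k + 1 by omega)]
    simp only [if_true]
    ring
  have hcross : Integrable fun t => d t * hermiteLine k t + hermiteLine k t * d t := by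
    have : ∀ t, d t * hermiteLine k t + hermiteLine k t * d t =
        2 * √(k / 2) * (hermiteLine (k - 1) t * hermiteLine k t) -
        2 * √((k + 1) / 2) * (hermiteLine (k + 1) t * hermiteLine k t) := by
      intro t; simp only [hd]; ring
    simp_rw [this]
    exact ((integrable_hermiteLine_mul _ _).const_mul _).sub
      ((integrable_hermiteLine_mul _ _).const_mul _)
  have hsum : Integrable fun t => hermiteLine k t * hermiteLine k t + d t * d t :=
    (integrable_hermiteLine_mul k k).add hid
  have hFTC := integral_Iic_of_hasDerivAt_of_tendsto' (a := t) (m := 0) (fun t _ => hda t)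
    hcross.integrableOn
    (tendsto_zero_of_hasDerivAt_of_integrableOn_Iic (a := t) (fun t _ => hda t)
      hcross.integrableOn (integrable_hermiteLine_mul k k).integrableOn)
  calc hermiteLine k t ^ 2 = hermiteLine k t * hermiteLine k t - 0 := by ring
    _ = ∫ t in Set.Iic t, (d t * hermiteLine k t + hermiteLine k t * d t) := hFTC.symm
    _ ≤ ∫ t in Set.Iic t, (hermiteLine k t * hermiteLine k t + d t * d t) := by
        refine setIntegral_mono hcross.integrableOn hsum.integrableOn fun t => ?_
        dsimp only
        nlinarith [sq_nonneg (hermiteLine k t - d t)]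
    _ ≤ ∫ t, (hermiteLine k t * hermiteLine k t + d t * d t) :=
        setIntegral_le_integral hsum (ae_of_all _ fun t => by
          have := mul_self_nonneg (hermiteLine k t)
          have := mul_self_nonneg (d t)
          simp only [Pi.zero_apply]; linarith)
    _ ≤ 2 * k + 2 := by
        rw [integral_add (integrable_hermiteLine_mul k k) hid, hIdd, integral_hermiteLine_mul,
          if_pos rfl]
        have : (0 : ℝ) ≤ k := k.cast_nonneg
        linarith

theorem abs_hermiteLine_le (k : ℕ) (t : ℝ) : |hermiteLine k t| ≤ k + 2 := by
  refine abs_le_of_sq_le_sq ?_ (by positivity)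
  have := sq_hermiteLine_le k t
  have : (0 : ℝ) ≤ k := k.cast_nonneg
  nlinarith

/-- By the ladder relations this quantity dominates both `|t h_k(t)|` and `|h_k'(t)|`, so one
constant serves for decay and for the Lipschitz bound. -/
theorem sqrt_mul_abs_add_le (k : ℕ) (t : ℝ) :
    √(k / 2) * |hermiteLine (k - 1) t| + √((k + 1) / 2) * |hermiteLine (k + 1) t| ≤
      2 * ((k : ℝ) + 2) ^ 2 := by
  have h0 : (0 : ℝ) ≤ k := k.cast_nonneg
  have h1 : |hermiteLine (k - 1) t| ≤ k + 2 := (abs_hermiteLine_le _ t).trans (by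
    have : ((k - 1 : ℕ) : ℝ) ≤ k := by exact_mod_cast Nat.sub_le k 1
    linarith)
  have h2 := abs_hermiteLine_le (k + 1) t
  have h3 : √((k : ℝ) / 2) ≤ k + 1 := Real.sqrt_le_iff.2 ⟨by positivity, by nlinarith⟩
  have h4 : √(((k : ℝ) + 1) / 2) ≤ k + 1 := Real.sqrt_le_iff.2 ⟨by positivity, by nlinarith⟩
  push_cast at h2
  calc _ ≤ ((k : ℝ) + 1) * (k + 2) + (k + 1) * (k + 1 + 2) := by gcongr
    _ ≤ _ := by nlinarith

theorem abs_mul_hermiteLine_le (k : ℕ) (t : ℝ) :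
    |t| * |hermiteLine k t| ≤ 2 * ((k : ℝ) + 2) ^ 2 := by
  rw [← abs_mul, mul_hermiteLine]
  refine (abs_add_le _ _).trans ?_
  rw [abs_mul, abs_mul, abs_of_nonneg (Real.sqrt_nonneg _), abs_of_nonneg (Real.sqrt_nonneg _)]
  exact sqrt_mul_abs_add_le k t

theorem abs_hermiteLine_sub_le (k : ℕ) (s t : ℝ) :
    |hermiteLine k s - hermiteLine k t| ≤ 2 * ((k : ℝ) + 2) ^ 2 * |s - t| := by
  have := Convex.norm_image_sub_le_of_norm_hasDerivWithin_le (s := Set.univ)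
    (C := 2 * ((k : ℝ) + 2) ^ 2)
    (fun x _ => (hasDerivAt_hermiteLine k x).hasDerivWithinAt) (fun x _ => by
      refine (norm_sub_le _ _).trans ?_
      rw [norm_mul, norm_mul, Real.norm_of_nonneg (Real.sqrt_nonneg _),
        Real.norm_of_nonneg (Real.sqrt_nonneg _)]
      exact sqrt_mul_abs_add_le k x) convex_univ (Set.mem_univ t) (Set.mem_univ s)
  simpa using this

/-! ### Explicit Hermite polynomials -/

/-- The explicit formula for the Hermite polynomials. -/
theorem eval_hermitePoly_eq_sum (k : ℕ) (t : ℝ) :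
    (hermitePoly k).eval t = k ! * ∑ m ∈ (Finset.range (k + 1)).filter (fun m => 2 * m ≤ k),
      (-1 : ℝ) ^ m / (m ! * (k - 2 * m)!) * (2 * t) ^ (k - 2 * m) := by
  -- The summands are extended by zero, so that sums for different `k` can be taken over a common
  -- range.
  set w : ℕ → ℕ → ℝ := fun k m =>
    if 2 * m ≤ k then (-1 : ℝ) ^ m / (m ! * (k - 2 * m)!) * (2 * t) ^ (k - 2 * m) else 0 with hw
  -- Kept free of division: at `2m = k + 1` both sides are zero.
  have hw1 (k m : ℕ) : ((k : ℝ) + 1 - 2 * m) * w (k + 1) m = 2 * t * w k m := by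
    simp only [hw]
    rcases lt_trichotomy (2 * m) (k + 1) with h | h | h
    · obtain ⟨j, rfl⟩ := Nat.exists_eq_add_of_le (Nat.lt_succ_iff.1 h)
      rw [if_pos (by omega), if_pos (by omega), show 2 * m + j + 1 - 2 * m = j + 1 by omega,
        show 2 * m + j - 2 * m = j by omega, Nat.factorial_succ]
      push_cast
      have : (j ! : ℝ) ≠ 0 := by positivity
      have : (m ! : ℝ) ≠ 0 := by positivity
      have : (j : ℝ) + 1 ≠ 0 := by positivity
      field_simp
      ring
    · rw [if_neg (show ¬ 2 * m ≤ k by omega)]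
      have : (k : ℝ) + 1 = 2 * m := by exact_mod_cast h.symm
      rw [this]; ring
    · rw [if_neg (by omega), if_neg (by omega)]; simp
  have hw2 (k m : ℕ) : ((m : ℝ) + 1) * w (k + 2) (m + 1) = -w k m := by
    simp only [hw]
    by_cases h : 2 * m ≤ k
    · rw [if_pos (by omega), if_pos h, show k + 2 - 2 * (m + 1) = k - 2 * m by omega,
        Nat.factorial_succ]
      push_cast
      have : ((k - 2 * m)! : ℝ) ≠ 0 := by positivity
      have : (m ! : ℝ) ≠ 0 := by positivity
      field_simp
      ring
    · rw [if_neg (by omega), if_neg h]; simp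
  have hwz (k m : ℕ) (h : k < 2 * m) : w k m = 0 := if_neg (by omega)
  have hrange (k N : ℕ) (hN : k ≤ N) :
      ∑ m ∈ Finset.range (N + 1), w k m = ∑ m ∈ Finset.range (k + 1), w k m := by
    symm
    refine Finset.sum_subset (by intro x; simp; omega) fun m _ hm => hwz _ _ ?_
    simp at hm; omega
  have key : ∀ k, (hermitePoly k).eval t = k ! * ∑ m ∈ Finset.range (k + 1), w k m := by
    intro k
    induction k using Nat.twoStepInduction with
    | zero => simp [hermitePoly, hw]
    | one => simp [hermitePoly, hw, Finset.sum_range_succ]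
    | more k ih1 ih2 =>
      rw [eval_hermitePoly_succ, Nat.add_sub_cancel, ih1, ih2]
      -- Split `k + 2 = (k + 2 - 2m) + 2m`: the first part lowers `k` by `hw1`, the second shifts
      -- `m` by `hw2`. This is the three-term recurrence divided by `(k + 1)!`.
      have e1 : ((k : ℝ) + 2) * ∑ m ∈ Finset.range (k + 2 + 1), w (k + 2) m =
          2 * t * ∑ m ∈ Finset.range (k + 1 + 1), w (k + 1) m -
          2 * ∑ m ∈ Finset.range (k + 1), w k m := by
        rw [← hrange (k + 1) (k + 2) (by omega), ← hrange k (k + 1) (by omega)]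
        have e2 : ∀ m, ((k : ℝ) + 2) * w (k + 2) m =
            2 * t * w (k + 1) m + 2 * m * w (k + 2) m := by
          intro m
          have := hw1 (k + 1) m
          push_cast at this
          linarith
        rw [Finset.mul_sum, Finset.sum_congr rfl fun m _ => e2 m, Finset.sum_add_distrib,
          ← Finset.mul_sum, Finset.sum_range_succ' (fun m => 2 * (m : ℝ) * w (k + 2) m)]
        have e3 : ∀ m, 2 * ((m + 1 : ℕ) : ℝ) * w (k + 2) (m + 1) = (-2) * w k m := by
          intro m
          have := hw2 k m
          push_cast
          linarith
        rw [Finset.sum_congr rfl fun m _ => e3 m, ← Finset.mul_sum]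
        push_cast; ring
      rw [Nat.factorial_succ (k + 1), Nat.factorial_succ k]
      push_cast
      linear_combination (-((k : ℝ) + 1) * k !) * e1
  rw [key, Finset.sum_filter]

/-! ### Hermite functions on `ℝⁿ` as products -/

variable {n : ℕ}

theorem partialDeriv_prod (i : Fin n) (g : Fin n → ℝ → ℝ) :
    partialDeriv i (fun x => ∏ j, g j (x j)) =
      fun x => ∏ j, Function.update g i (deriv (g i)) j (x j) := by
  funext x
  have h1 (t : ℝ) : ∏ j, g j ((x + t • EuclideanSpace.single i (1 : ℝ)) j) =
      g i (x i + t) * ∏ j ∈ Finset.univ.erase i, g j (x j) := by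
    rw [← Finset.mul_prod_erase _ _ (Finset.mem_univ i)]
    congr 1
    · simp
    · refine Finset.prod_congr rfl fun j hj => ?_
      simp [Finset.ne_of_mem_erase hj]
  rw [partialDeriv, lineDeriv]
  simp_rw [h1]
  rw [deriv_mul_const_field, deriv_comp_const_add, add_zero,
    ← Finset.mul_prod_erase _ _ (Finset.mem_univ i), Function.update_self]
  congr 1
  refine Finset.prod_congr rfl fun j hj => ?_
  rw [Function.update_of_ne (Finset.ne_of_mem_erase hj)]

theorem iterate_partialDeriv_prod (i : Fin n) (k : ℕ) (g : Fin n → ℝ → ℝ) :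
    (partialDeriv i)^[k] (fun x => ∏ j, g j (x j)) =
      fun x => ∏ j, Function.update g i (deriv^[k] (g i)) j (x j) := by
  induction k with
  | zero => simp
  | succ k ih =>
    rw [Function.iterate_succ_apply', ih, partialDeriv_prod, Function.update_self,
      Function.update_idem, ← Function.iterate_succ_apply' deriv]

theorem iteratedPartialDeriv_prod (α : Fin n → ℕ) (g : Fin n → ℝ → ℝ) :
    iteratedPartialDeriv α (fun x => ∏ j, g j (x j)) =
      fun x => ∏ j, (deriv^[α j] (g j)) (x j) := by
  -- Induction on the list of variables already treated; without duplicates, each factor is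
  -- differentiated in only one round.
  have key : ∀ l : List (Fin n), l.Nodup →
      l.foldr (fun i f => (partialDeriv i)^[α i] f) (fun x => ∏ j, g j (x j)) =
        fun x => ∏ j, (if j ∈ l then deriv^[α j] (g j) else g j) (x j) := by
    intro l
    induction l with
    | nil => simp
    | cons i l ih =>
      intro hl
      rw [List.nodup_cons] at hl
      rw [List.foldr_cons, ih hl.2,
        iterate_partialDeriv_prod i (α i) (fun j => if j ∈ l then deriv^[α j] (g j) else g j)]
      funext x
      refine Finset.prod_congr rfl fun j _ => ?_
      by_cases hj : j = i
      · subst hj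
        simp [hl.1]
      · simp [hj]
  rw [iteratedPartialDeriv, key _ (List.nodup_finRange n)]
  simp

theorem exp_neg_norm_sq (x : EuclideanSpace ℝ (Fin n)) :
    Real.exp (-‖x‖ ^ 2) = ∏ i, Real.exp (-x i ^ 2) := by
  rw [← Real.exp_sum, EuclideanSpace.norm_sq_eq, Finset.sum_neg_distrib]
  simp

theorem exp_neg_norm_sq_half (x : EuclideanSpace ℝ (Fin n)) :
    Real.exp (-‖x‖ ^ 2 / 2) = ∏ i, Real.exp (-x i ^ 2 / 2) := by
  rw [← Real.exp_sum, EuclideanSpace.norm_sq_eq, ← Finset.sum_div, Finset.sum_neg_distrib]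
  simp

theorem prod_hermiteConst (α : Fin n → ℕ) : ∏ i, hermiteConst (α i) =
    (Real.pi ^ ((n : ℝ) / 4) * 2 ^ ((order α : ℝ) / 2) * √(factorial α))⁻¹ := by
  have hp := Real.pi_pos
  have h (k : ℕ) : hermiteConst k = (Real.pi ^ ((1 : ℝ) / 4) * 2 ^ ((k : ℝ) / 2) * √(k !))⁻¹ := by
    rw [hermiteConst, Real.sqrt_mul (by positivity), Real.sqrt_mul (by positivity)]
    congr 3
    · rw [Real.sqrt_eq_rpow, Real.sqrt_eq_rpow, ← Real.rpow_mul hp.le]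
      norm_num
    · rw [Real.sqrt_eq_rpow, ← Real.rpow_natCast, ← Real.rpow_mul (by norm_num)]
      ring_nf
  simp_rw [h]
  rw [Finset.prod_inv_distrib, Finset.prod_mul_distrib, Finset.prod_mul_distrib]
  congr 3
  · rw [Finset.prod_const, ← Real.rpow_mul_natCast hp.le]
    simp
    ring_nf
  · rw [← Real.rpow_sum_of_pos (by norm_num), order]
    push_cast
    rw [Finset.sum_div]
  · rw [factorial, Nat.cast_prod, Real.sqrt_eq_rpow,
      ← Real.finsetProd_rpow _ _ (fun i _ => by positivity)]
    simp_rw [Real.sqrt_eq_rpow]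

/-- The Gaussian is a product of one-variable functions, so the derivative factors. The sign in the
definition cancels the sign from the derivatives of `e^{-t²}`. -/
theorem hermiteFun_eq_prod (α : Fin n → ℕ) (x : EuclideanSpace ℝ (Fin n)) :
    hermiteFun α x = ∏ i, hermiteLine (α i) (x i) := by
  have h1 : (fun y : EuclideanSpace ℝ (Fin n) => Real.exp (-‖y‖ ^ 2)) =
      fun y => ∏ i, Real.exp (-y i ^ 2) := funext exp_neg_norm_sq
  rw [hermiteFun, h1, iteratedPartialDeriv_prod α (fun _ t => Real.exp (-t ^ 2))]
  simp_rw [iterate_deriv_exp_neg_sq, hermiteLine]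
  rw [Finset.prod_mul_distrib, Finset.prod_mul_distrib, Finset.prod_mul_distrib,
    Finset.prod_mul_distrib, prod_hermiteConst, Finset.prod_pow_eq_pow_sum,
    ← exp_neg_norm_sq, ← exp_neg_norm_sq_half, ← order]
  have h2 : Real.exp (-‖x‖ ^ 2 / 2) = Real.exp (‖x‖ ^ 2 / 2) * Real.exp (-‖x‖ ^ 2) := by
    rw [← Real.exp_add]; ring_nf
  have h3 : ((-1 : ℝ) ^ order α) * (-1) ^ order α = 1 := by
    rw [← mul_pow]; simp
  rw [h2, div_eq_mul_inv]
  linear_combination ((Real.pi ^ ((n : ℝ) / 4) * 2 ^ ((order α : ℝ) / 2) * √(factorial α))⁻¹ *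
    Real.exp (‖x‖ ^ 2 / 2) * (∏ i, (hermitePoly (α i)).eval (x i)) * Real.exp (-‖x‖ ^ 2)) * h3

theorem integral_euclideanSpace_prod (g : Fin n → ℝ → ℝ) :
    ∫ x : EuclideanSpace ℝ (Fin n), ∏ i, g i (x i) = ∏ i, ∫ t, g i t := by
  rw [← integral_fintype_prod_volume_eq_prod]
  exact (EuclideanSpace.volume_preserving_symm_measurableEquiv_toLp (Fin n)).integral_comp
    (MeasurableEquiv.measurableEmbedding _) (fun y : Fin n → ℝ => ∏ i, g i (y i))

theorem integral_hermiteFun_mul_hermiteFun (α β : Fin n → ℕ) :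
    ∫ x : EuclideanSpace ℝ (Fin n), hermiteFun α x * hermiteFun β x =
      if α = β then 1 else 0 := by
  simp_rw [hermiteFun_eq_prod, ← Finset.prod_mul_distrib]
  rw [integral_euclideanSpace_prod (fun i t => hermiteLine (α i) t * hermiteLine (β i) t)]
  simp_rw [integral_hermiteLine_mul]
  split_ifs with h
  · subst h; simp
  · obtain ⟨i, hi⟩ := Function.ne_iff.1 h
    exact Finset.prod_eq_zero (Finset.mem_univ i) (if_neg hi)

/-! ### Polynomials times the Gaussian as Schwartz functions -/

section Gaussian

/-- Combine `(1 + r)^N ≤ N! e^{1+r}` with `1 + r ≤ 3/2 + r²/2`, which is `(r - 1)² ≥ 0`. -/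
theorem one_add_pow_mul_exp_le (N : ℕ) {r : ℝ} (hr : 0 ≤ r) :
    (1 + r) ^ N * Real.exp (-r ^ 2 / 2) ≤ N ! * Real.exp (3 / 2) := by
  have h1 : (1 + r) ^ N / N ! ≤ Real.exp (1 + r) :=
    Real.pow_div_factorial_le_exp (1 + r) (by positivity) N
  have h2 : Real.exp (1 + r) ≤ Real.exp (3 / 2) * Real.exp (r ^ 2 / 2) := by
    rw [← Real.exp_add]
    exact Real.exp_le_exp.2 (by nlinarith [sq_nonneg (r - 1)])
  have h3 : Real.exp (-r ^ 2 / 2) * Real.exp (r ^ 2 / 2) = 1 := by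
    rw [← Real.exp_add]; ring_nf; simp
  rw [div_le_iff₀ (by positivity)] at h1
  calc (1 + r) ^ N * Real.exp (-r ^ 2 / 2)
      ≤ (Real.exp (3 / 2) * Real.exp (r ^ 2 / 2) * N !) * Real.exp (-r ^ 2 / 2) := by
        gcongr
        exact h1.trans (by gcongr)
    _ = N ! * Real.exp (3 / 2) := by linear_combination (Real.exp (3 / 2) * N !) * h3

/-- The Gaussian `exp (-|x|² / 2)` as a Schwartz function. -/
noncomputable def gaussianReal : 𝓢(EuclideanSpace ℝ (Fin n), ℝ) where
  toFun x := Real.exp (-‖x‖ ^ 2 / 2)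
  smooth' := Real.contDiff_exp.comp ((contDiff_norm_sq ℝ).neg.div_const 2)
  decay' := by
    intro k m
    have hT : (fun x : EuclideanSpace ℝ (Fin n) => -‖x‖ ^ 2 / 2).HasTemperateGrowth := by
      have : (fun x : EuclideanSpace ℝ (Fin n) => -‖x‖ ^ 2 / 2) =
          fun x => (-1 / 2 : ℝ) * ‖x‖ ^ 2 := by funext x; ring
      rw [this]
      fun_prop
    obtain ⟨K, C, hC, hb⟩ := hT.norm_iteratedFDeriv_le_uniform m
    refine ⟨m ! * (1 + C) ^ m * ((k + K * m)! * Real.exp (3 / 2)), fun x => ?_⟩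
    -- Faà di Bruno bound: every derivative of `exp` is `exp`, and the exponent has temperate
    -- growth. The bound `D` is at least `1`, so it is at most `D ^ i` for `i ≥ 1`, as required.
    have h1 := norm_iteratedFDeriv_comp_le (𝕜 := ℝ) (g := Real.exp)
      (f := fun x : EuclideanSpace ℝ (Fin n) => -‖x‖ ^ 2 / 2) (n := m) (N := ∞)
      Real.contDiff_exp hT.1 (by exact_mod_cast le_top) x (C := Real.exp (-‖x‖ ^ 2 / 2))
      (D := (1 + C) * (1 + ‖x‖) ^ K) (fun i _ => by
        rw [norm_iteratedFDeriv_eq_norm_iteratedDeriv, iteratedDeriv_eq_iterate,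
          Real.iter_deriv_exp, Real.norm_of_nonneg (Real.exp_pos _).le]) (fun i hi him => by
        have hone : 1 ≤ (1 + ‖x‖) ^ K := one_le_pow₀ (by linarith [norm_nonneg x])
        have : 1 ≤ (1 + C) * (1 + ‖x‖) ^ K := by nlinarith
        refine (hb i him x).trans (le_trans ?_ (le_self_pow₀ this (by omega)))
        gcongr
        linarith)
    have hx := norm_nonneg x
    calc ‖x‖ ^ k * ‖iteratedFDeriv ℝ m (fun x => Real.exp (-‖x‖ ^ 2 / 2)) x‖
        ≤ (1 + ‖x‖) ^ k * (m ! * Real.exp (-‖x‖ ^ 2 / 2) * ((1 + C) * (1 + ‖x‖) ^ K) ^ m) := by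
          gcongr
          · linarith
          · exact h1
      _ = m ! * (1 + C) ^ m * ((1 + ‖x‖) ^ (k + K * m) * Real.exp (-‖x‖ ^ 2 / 2)) := by
          rw [mul_pow, ← pow_mul, pow_add]; ring
      _ ≤ _ := by
          exact mul_le_mul_of_nonneg_left (one_add_pow_mul_exp_le _ hx) (by positivity)

theorem gaussianReal_apply (x : EuclideanSpace ℝ (Fin n)) :
    gaussianReal x = Real.exp (-‖x‖ ^ 2 / 2) := rfl

theorem hasTemperateGrowth_prod_eval (P : Fin n → Polynomial ℝ) :
    (fun x : EuclideanSpace ℝ (Fin n) => ∏ i, (P i).eval (x i)).HasTemperateGrowth := by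
  have h1 (i : Fin n) :
      (fun x : EuclideanSpace ℝ (Fin n) => (P i).eval (x i)).HasTemperateGrowth := by
    have h2 : (fun x : EuclideanSpace ℝ (Fin n) => x i).HasTemperateGrowth :=
      (EuclideanSpace.proj i : EuclideanSpace ℝ (Fin n) →L[ℝ] ℝ).hasTemperateGrowth
    simp_rw [Polynomial.eval_eq_sum_range]
    exact Function.HasTemperateGrowth.sum fun j _ =>
      (Function.HasTemperateGrowth.const _).mul (h2.pow j)
  have h2 (s : Finset (Fin n)) :
      (fun x : EuclideanSpace ℝ (Fin n) => ∏ i ∈ s, (P i).eval (x i)).HasTemperateGrowth := by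
    induction s using Finset.cons_induction with
    | empty => simp
    | cons i s hi ih =>
      simp_rw [Finset.prod_cons]
      exact (h1 i).mul ih
  exact h2 Finset.univ

theorem exists_schwartzMap_ofReal (f : 𝓢(EuclideanSpace ℝ (Fin n), ℝ)) :
    ∃ g : 𝓢(EuclideanSpace ℝ (Fin n), ℂ), ∀ x, g x = (f x : ℂ) := by
  refine ⟨⟨fun x => (f x : ℂ), Complex.ofRealCLM.contDiff.comp (f.smooth ⊤), fun k m => ?_⟩,
    fun x => rfl⟩
  obtain ⟨C, hC⟩ := f.decay' k m
  refine ⟨C, fun x => ?_⟩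
  have := LinearIsometry.norm_iteratedFDeriv_comp_left (i := m) Complex.ofRealLI
    ((f.smooth ⊤).contDiffAt (x := x)) (by exact_mod_cast le_top)
  rw [show (fun x => (f x : ℂ)) = Complex.ofRealLI ∘ f from rfl, this]
  exact hC x

/-- The product of one-variable polynomials and the Gaussian, as a Schwartz function. -/
noncomputable def polyGaussian (P : Fin n → Polynomial ℝ) : 𝓢(EuclideanSpace ℝ (Fin n), ℂ) :=
  (exists_schwartzMap_ofReal (SchwartzMap.smulLeftCLM ℝ
    (fun x : EuclideanSpace ℝ (Fin n) => ∏ i, (P i).eval (x i)) gaussianReal)).choose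

theorem polyGaussian_apply (P : Fin n → Polynomial ℝ) (x : EuclideanSpace ℝ (Fin n)) :
    polyGaussian P x = (((∏ i, (P i).eval (x i)) * Real.exp (-‖x‖ ^ 2 / 2) : ℝ) : ℂ) := by
  rw [polyGaussian, (exists_schwartzMap_ofReal _).choose_spec,
    SchwartzMap.smulLeftCLM_apply_apply (hasTemperateGrowth_prod_eval P), gaussianReal_apply,
    smul_eq_mul]

/-- The Hermite function `h_α` as a Schwartz function. -/
noncomputable def hermiteSchwartz (α : Fin n → ℕ) : 𝓢(EuclideanSpace ℝ (Fin n), ℂ) :=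
  polyGaussian fun i => Polynomial.C (hermiteConst (α i)) * hermitePoly (α i)

theorem hermiteSchwartz_apply (α : Fin n → ℕ) (x : EuclideanSpace ℝ (Fin n)) :
    hermiteSchwartz α x = (hermiteFun α x : ℂ) := by
  rw [hermiteSchwartz, polyGaussian_apply, hermiteFun_eq_prod, exp_neg_norm_sq_half,
    ← Finset.prod_mul_distrib]
  simp [hermiteLine]

end Gaussian

/-! ### Ladder relations and polynomial bounds on `ℝⁿ` -/

theorem hermiteFun_update (α : Fin n → ℕ) (i : Fin n) (k : ℕ) (x : EuclideanSpace ℝ (Fin n)) :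
    hermiteFun (Function.update α i k) x =
      hermiteLine k (x i) * ∏ j ∈ Finset.univ.erase i, hermiteLine (α j) (x j) := by
  rw [hermiteFun_eq_prod, ← Finset.mul_prod_erase _ _ (Finset.mem_univ i), Function.update_self]
  congr 1
  refine Finset.prod_congr rfl fun j hj => ?_
  rw [Function.update_of_ne (Finset.ne_of_mem_erase hj)]

theorem hermiteFun_eq_mul_prod_erase (α : Fin n → ℕ) (i : Fin n) (x : EuclideanSpace ℝ (Fin n)) :
    hermiteFun α x =
      hermiteLine (α i) (x i) * ∏ j ∈ Finset.univ.erase i, hermiteLine (α j) (x j) := by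
  rw [← hermiteFun_update, Function.update_eq_self]

theorem coord_mul_hermiteFun (α : Fin n → ℕ) (i : Fin n) (x : EuclideanSpace ℝ (Fin n)) :
    x i * hermiteFun α x = √(α i / 2) * hermiteFun (Function.update α i (α i - 1)) x +
      √((α i + 1) / 2) * hermiteFun (Function.update α i (α i + 1)) x := by
  rw [hermiteFun_update, hermiteFun_update, hermiteFun_eq_mul_prod_erase α i, ← mul_assoc,
    mul_hermiteLine]
  ring

open scoped LineDeriv in
theorem lineDerivOp_hermiteSchwartz (α : Fin n → ℕ) (i : Fin n)
    (x : EuclideanSpace ℝ (Fin n)) :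
    (∂_{EuclideanSpace.single i (1 : ℝ)} (hermiteSchwartz α)) x =
      ((√(α i / 2) * hermiteFun (Function.update α i (α i - 1)) x -
        √((α i + 1) / 2) * hermiteFun (Function.update α i (α i + 1)) x : ℝ) : ℂ) := by
  rw [SchwartzMap.lineDerivOp_apply, lineDeriv]
  have h1 (t : ℝ) : hermiteSchwartz α (x + t • EuclideanSpace.single i (1 : ℝ)) =
      ((hermiteLine (α i) (x i + t) *
        ∏ j ∈ Finset.univ.erase i, hermiteLine (α j) (x j) : ℝ) : ℂ) := by
    rw [hermiteSchwartz_apply, hermiteFun_eq_mul_prod_erase α i]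
    congr 2
    · simp
    · refine Finset.prod_congr rfl fun j hj => ?_
      simp [Finset.ne_of_mem_erase hj]
  simp_rw [h1]
  have h2 : HasDerivAt (fun t : ℝ => hermiteLine (α i) (x i + t))
      (√(α i / 2) * hermiteLine (α i - 1) (x i) -
        √((α i + 1) / 2) * hermiteLine (α i + 1) (x i)) 0 := by
    have := hasDerivAt_hermiteLine (α i) (x i + 0)
    rw [add_zero] at this
    exact HasDerivAt.comp_const_add (x i) 0 (by simpa using this)
  rw [((h2.mul_const _).ofReal_comp).deriv, hermiteFun_update, hermiteFun_update]
  congr 1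
  ring

/-- A polynomially growing bound for the Hermite functions and their first derivatives. -/
noncomputable def hermiteBound (α : Fin n → ℕ) : ℝ := ∏ i, (2 * ((α i : ℝ) + 2) ^ 2)

theorem hermiteBound_nonneg (α : Fin n → ℕ) : 0 ≤ hermiteBound α :=
  Finset.prod_nonneg fun _ _ => by positivity

theorem abs_hermiteLine_le' (k : ℕ) (t : ℝ) : |hermiteLine k t| ≤ 2 * ((k : ℝ) + 2) ^ 2 := by
  have := abs_hermiteLine_le k t
  have : (0 : ℝ) ≤ k := k.cast_nonneg
  nlinarith

theorem abs_hermiteFun_le (α : Fin n → ℕ) (x : EuclideanSpace ℝ (Fin n)) :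
    |hermiteFun α x| ≤ hermiteBound α := by
  rw [hermiteFun_eq_prod, Finset.abs_prod]
  exact Finset.prod_le_prod (fun _ _ => abs_nonneg _) fun i _ => abs_hermiteLine_le' _ _

theorem norm_le_sum_abs (x : EuclideanSpace ℝ (Fin n)) : ‖x‖ ≤ ∑ i, |x i| := by
  refine le_of_sq_le_sq ?_ (Finset.sum_nonneg fun _ _ => abs_nonneg _)
  rw [EuclideanSpace.norm_sq_eq]
  exact Finset.sum_sq_le_sq_sum_of_nonneg fun _ _ => abs_nonneg _

/-- After `|x| ≤ ∑ |x_i|`, the factor `|x_i|` is absorbed by the `i`-th one-variable function at no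
cost beyond `hermiteBound`. -/
theorem norm_mul_abs_hermiteFun_le (α : Fin n → ℕ) (x : EuclideanSpace ℝ (Fin n)) :
    ‖x‖ * |hermiteFun α x| ≤ n * hermiteBound α := by
  have h (i : Fin n) : |x i| * |hermiteFun α x| ≤ hermiteBound α := by
    rw [hermiteFun_eq_mul_prod_erase α i, abs_mul, ← mul_assoc, hermiteBound,
      ← Finset.mul_prod_erase _ _ (Finset.mem_univ i), Finset.abs_prod]
    exact mul_le_mul (abs_mul_hermiteLine_le _ _)
      (Finset.prod_le_prod (fun _ _ => abs_nonneg _) fun i _ => abs_hermiteLine_le' _ _)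
      (Finset.prod_nonneg fun _ _ => abs_nonneg _) (by positivity)
  calc ‖x‖ * |hermiteFun α x| ≤ (∑ i, |x i|) * |hermiteFun α x| := by
        gcongr; exact norm_le_sum_abs x
    _ = ∑ i, |x i| * |hermiteFun α x| := Finset.sum_mul ..
    _ ≤ ∑ _i : Fin n, hermiteBound α := Finset.sum_le_sum fun i _ => h i
    _ = n * hermiteBound α := by simp

/-- Telescoping: replace one factor at a time. It turns the one-variable Lipschitz bounds into one
for the product. -/
theorem abs_prod_sub_prod_le {ι : Type*} (s : Finset ι) (a b M : ι → ℝ) {d : ℝ} (hd : 0 ≤ d)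
    (ha : ∀ i, |a i| ≤ M i) (hb : ∀ i, |b i| ≤ M i) (hab : ∀ i, |a i - b i| ≤ M i * d) :
    |∏ i ∈ s, a i - ∏ i ∈ s, b i| ≤ s.card * (∏ i ∈ s, M i) * d := by
  have hM (i : ι) : 0 ≤ M i := (abs_nonneg _).trans (ha i)
  induction s using Finset.cons_induction with
  | empty => simp
  | cons i s hi ih =>
    rw [Finset.prod_cons, Finset.prod_cons, Finset.prod_cons, Finset.card_cons]
    have e : a i * ∏ i ∈ s, a i - b i * ∏ i ∈ s, b i =
        (a i - b i) * ∏ i ∈ s, a i + b i * (∏ i ∈ s, a i - ∏ i ∈ s, b i) := by ring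
    rw [e]
    refine (abs_add_le _ _).trans ?_
    rw [abs_mul, abs_mul]
    have h1 : |∏ i ∈ s, a i| ≤ ∏ i ∈ s, M i := by
      rw [Finset.abs_prod]
      exact Finset.prod_le_prod (fun _ _ => abs_nonneg _) fun i _ => ha i
    have hP : 0 ≤ ∏ i ∈ s, M i := Finset.prod_nonneg fun i _ => hM i
    calc |a i - b i| * |∏ i ∈ s, a i| + |b i| * |∏ i ∈ s, a i - ∏ i ∈ s, b i|
        ≤ (M i * d) * (∏ i ∈ s, M i) + M i * (s.card * (∏ i ∈ s, M i) * d) := by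
          refine add_le_add (mul_le_mul (hab i) h1 (abs_nonneg _) ?_)
            (mul_le_mul (hb i) ih (abs_nonneg _) (hM i))
          exact mul_nonneg (hM i) hd
      _ = _ := by push_cast; ring

theorem abs_hermiteFun_sub_le (α : Fin n → ℕ) (x : EuclideanSpace ℝ (Fin n)) :
    |hermiteFun α x - hermiteFun α 0| ≤ n * hermiteBound α * ‖x‖ := by
  rw [hermiteFun_eq_prod, hermiteFun_eq_prod]
  have := abs_prod_sub_prod_le Finset.univ (fun i => hermiteLine (α i) (x i))
    (fun i => hermiteLine (α i) ((0 : EuclideanSpace ℝ (Fin n)) i))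
    (fun i => 2 * ((α i : ℝ) + 2) ^ 2) (norm_nonneg x)
    (fun i => abs_hermiteLine_le' _ _) (fun i => abs_hermiteLine_le' _ _) (fun i => by
      refine (abs_hermiteLine_sub_le _ _ _).trans ?_
      gcongr
      simpa using PiLp.norm_apply_le x i)
  simpa [hermiteBound] using this

theorem continuous_hermiteFun (α : Fin n → ℕ) : Continuous (hermiteFun α) := by
  have : hermiteFun α = fun x => ∏ i, hermiteLine (α i) (x i) :=
    funext (hermiteFun_eq_prod α)
  rw [this]
  exact continuous_finsetProd _ fun i _ => (continuous_hermiteLine _).comp (by fun_prop)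

theorem continuous_ofReal_hermiteFun (α : Fin n → ℕ) :
    Continuous fun x => (hermiteFun α x : ℂ) :=
  Complex.continuous_ofReal.comp (continuous_hermiteFun α)

theorem integrable_hermiteFun (α : Fin n → ℕ) :
    Integrable fun x : EuclideanSpace ℝ (Fin n) => (hermiteFun α x : ℂ) := by
  simp_rw [← hermiteSchwartz_apply]
  exact (hermiteSchwartz α).integrable

theorem integrable_hermiteFun_mul (α : Fin n → ℕ) {f : EuclideanSpace ℝ (Fin n) → ℂ}
    (hf : Integrable f) : Integrable fun x => (hermiteFun α x : ℂ) * f x :=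
  hf.bdd_mul (c := hermiteBound α) (continuous_ofReal_hermiteFun α).aestronglyMeasurable
    (ae_of_all _ fun x => by simpa using abs_hermiteFun_le α x)

/-! ### Hermite coefficients and their rapid decay -/

/-- The Hermite coefficient `∫ h_α f`. -/
noncomputable def hermiteCoef (α : Fin n → ℕ) (f : EuclideanSpace ℝ (Fin n) → ℂ) : ℂ :=
  ∫ x, (hermiteFun α x : ℂ) * f x

theorem norm_hermiteCoef_le (α : Fin n → ℕ) (f : 𝓢(EuclideanSpace ℝ (Fin n), ℂ)) :
    ‖hermiteCoef α f‖ ≤ hermiteBound α * ∫ x, ‖f x‖ := by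
  rw [hermiteCoef, ← integral_const_mul]
  refine norm_integral_le_of_norm_le (f.integrable.norm.const_mul _) (ae_of_all _ fun x => ?_)
  rw [norm_mul]
  gcongr
  simpa using abs_hermiteFun_le α x

theorem hermiteCoef_hermiteFun (α β : Fin n → ℕ) :
    hermiteCoef α (fun x => (hermiteFun β x : ℂ)) = if α = β then 1 else 0 := by
  have := integral_hermiteFun_mul_hermiteFun α β
  rw [hermiteCoef]
  simp_rw [← Complex.ofReal_mul]
  rw [integral_complex_ofReal, this]
  split_ifs <;> simp

section Ladder

open scoped LineDeriv

/-- Multiplication by the `i`-th coordinate on Schwartz functions. -/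
noncomputable def coordMul (i : Fin n) (f : 𝓢(EuclideanSpace ℝ (Fin n), ℂ)) :
    𝓢(EuclideanSpace ℝ (Fin n), ℂ) :=
  SchwartzMap.smulLeftCLM ℂ (fun x : EuclideanSpace ℝ (Fin n) => x i) f

theorem coordMul_apply (i : Fin n) (f : 𝓢(EuclideanSpace ℝ (Fin n), ℂ))
    (x : EuclideanSpace ℝ (Fin n)) : coordMul i f x = (x i : ℂ) * f x := by
  have h2 : (fun x : EuclideanSpace ℝ (Fin n) => x i).HasTemperateGrowth :=
    (EuclideanSpace.proj i : EuclideanSpace ℝ (Fin n) →L[ℝ] ℝ).hasTemperateGrowth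
  rw [coordMul, SchwartzMap.smulLeftCLM_apply_apply h2, Complex.real_smul]

theorem hermiteCoef_coordMul (α : Fin n → ℕ) (i : Fin n)
    (f : 𝓢(EuclideanSpace ℝ (Fin n), ℂ)) :
    hermiteCoef α (coordMul i f) =
      √(α i / 2) * hermiteCoef (Function.update α i (α i - 1)) f +
      √((α i + 1) / 2) * hermiteCoef (Function.update α i (α i + 1)) f := by
  simp only [hermiteCoef]
  rw [← integral_const_mul, ← integral_const_mul, ← integral_add
    ((integrable_hermiteFun_mul _ f.integrable).const_mul _)
    ((integrable_hermiteFun_mul _ f.integrable).const_mul _)]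
  refine integral_congr_ae (ae_of_all _ fun x => ?_)
  have := congrArg (fun r : ℝ => (r : ℂ)) (coord_mul_hermiteFun α i x)
  push_cast at this
  simp only [coordMul_apply]
  linear_combination (f x) * this

theorem hermiteCoef_lineDerivOp (α : Fin n → ℕ) (i : Fin n)
    (f : 𝓢(EuclideanSpace ℝ (Fin n), ℂ)) :
    hermiteCoef α (∂_{EuclideanSpace.single i (1 : ℝ)} f : 𝓢(EuclideanSpace ℝ (Fin n), ℂ)) =
      √((α i + 1) / 2) * hermiteCoef (Function.update α i (α i + 1)) f -
      √(α i / 2) * hermiteCoef (Function.update α i (α i - 1)) f := by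
  simp only [hermiteCoef]
  simp_rw [← hermiteSchwartz_apply α]
  rw [SchwartzMap.integral_mul_lineDerivOp_right_eq_neg_left, ← integral_neg,
    ← integral_const_mul, ← integral_const_mul, ← integral_sub
    ((integrable_hermiteFun_mul _ f.integrable).const_mul _)
    ((integrable_hermiteFun_mul _ f.integrable).const_mul _)]
  refine integral_congr_ae (ae_of_all _ fun x => ?_)
  simp only [lineDerivOp_hermiteSchwartz]
  push_cast
  ring

theorem hermiteCoef_add (α : Fin n → ℕ) (f g : 𝓢(EuclideanSpace ℝ (Fin n), ℂ)) :
    hermiteCoef α (f + g : 𝓢(EuclideanSpace ℝ (Fin n), ℂ)) =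
      hermiteCoef α f + hermiteCoef α g := by
  simp only [hermiteCoef]
  rw [← integral_add (integrable_hermiteFun_mul _ f.integrable)
    (integrable_hermiteFun_mul _ g.integrable)]
  simp [mul_add]

theorem hermiteCoef_sub (α : Fin n → ℕ) (f g : 𝓢(EuclideanSpace ℝ (Fin n), ℂ)) :
    hermiteCoef α (f - g : 𝓢(EuclideanSpace ℝ (Fin n), ℂ)) =
      hermiteCoef α f - hermiteCoef α g := by
  simp only [hermiteCoef]
  rw [← integral_sub (integrable_hermiteFun_mul _ f.integrable)
    (integrable_hermiteFun_mul _ g.integrable)]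
  simp [mul_sub]

/-- Take `g = (x_i + ∂_i)(x_i - ∂_i) f`. The raising operator acts first, so the multiplier is
`2(α_i + 1)`, which never vanishes, unlike `2α_i` for the opposite order. -/
theorem exists_hermiteCoef_eq_mul (i : Fin n) (f : 𝓢(EuclideanSpace ℝ (Fin n), ℂ)) :
    ∃ g : 𝓢(EuclideanSpace ℝ (Fin n), ℂ), ∀ α,
      hermiteCoef α g = (2 * ((α i : ℂ) + 1)) * hermiteCoef α f := by
  set r := coordMul i f - ∂_{EuclideanSpace.single i (1 : ℝ)} f with hr
  refine ⟨coordMul i r + ∂_{EuclideanSpace.single i (1 : ℝ)} r, fun α => ?_⟩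
  have h1 (β : Fin n → ℕ) : hermiteCoef β r =
      2 * √(β i / 2) * hermiteCoef (Function.update β i (β i - 1)) f := by
    rw [hr, hermiteCoef_sub, hermiteCoef_coordMul, hermiteCoef_lineDerivOp]
    ring
  rw [hermiteCoef_add, hermiteCoef_coordMul, hermiteCoef_lineDerivOp,
    h1 (Function.update α i (α i + 1))]
  simp only [Function.update_self, Function.update_idem, Nat.add_sub_cancel,
    Function.update_eq_self]
  have h2 : ((√(((α i : ℝ) + 1) / 2) : ℝ) : ℂ) * ((√(((α i : ℝ) + 1) / 2) : ℝ) : ℂ) =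
      ((α i : ℂ) + 1) / 2 := by
    rw [← Complex.ofReal_mul, Real.mul_self_sqrt (by positivity)]
    push_cast; ring
  push_cast
  linear_combination (4 * hermiteCoef α f) * h2

theorem exists_hermiteCoef_eq_pow_mul (i : Fin n) (N : ℕ)
    (f : 𝓢(EuclideanSpace ℝ (Fin n), ℂ)) :
    ∃ g : 𝓢(EuclideanSpace ℝ (Fin n), ℂ), ∀ α,
      hermiteCoef α g = (2 * ((α i : ℂ) + 1)) ^ N * hermiteCoef α f := by
  induction N with
  | zero => exact ⟨f, by simp⟩
  | succ N ih =>
    obtain ⟨g, hg⟩ := ih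
    obtain ⟨g', hg'⟩ := exists_hermiteCoef_eq_mul i g
    exact ⟨g', fun α => by rw [hg', hg]; ring⟩

theorem exists_hermiteCoef_eq_prod_pow_mul (N : ℕ) (f : 𝓢(EuclideanSpace ℝ (Fin n), ℂ)) :
    ∃ g : 𝓢(EuclideanSpace ℝ (Fin n), ℂ), ∀ α,
      hermiteCoef α g = (∏ i, (2 * ((α i : ℂ) + 1)) ^ N) * hermiteCoef α f := by
  suffices ∀ s : Finset (Fin n), ∃ g : 𝓢(EuclideanSpace ℝ (Fin n), ℂ), ∀ α,
      hermiteCoef α g = (∏ i ∈ s, (2 * ((α i : ℂ) + 1)) ^ N) * hermiteCoef α f from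
    this Finset.univ
  intro s
  induction s using Finset.cons_induction with
  | empty => exact ⟨f, by simp⟩
  | cons i s hi ih =>
    obtain ⟨g, hg⟩ := ih
    obtain ⟨g', hg'⟩ := exists_hermiteCoef_eq_pow_mul i N g
    exact ⟨g', fun α => by rw [hg', hg, Finset.prod_cons]; ring⟩

end Ladder

/-- A finite set of multi-indices lies in a box, and over a box the sum of products is a product of
sums. -/
theorem summable_prod_of_nonneg {u : ℕ → ℝ} (hu0 : ∀ k, 0 ≤ u k) (hu : Summable u) :
    Summable fun α : Fin n → ℕ => ∏ i, u (α i) := by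
  refine summable_of_sum_le (c := ∏ _i : Fin n, ∑' k, u k)
    (fun α => Finset.prod_nonneg fun _ _ => hu0 _) fun s => ?_
  calc ∑ α ∈ s, ∏ i, u (α i)
      ≤ ∑ α ∈ Fintype.piFinset fun i => s.image (fun α => α i), ∏ i, u (α i) := by
        refine Finset.sum_le_sum_of_subset_of_nonneg (fun α hα => ?_)
          fun _ _ _ => Finset.prod_nonneg fun _ _ => hu0 _
        exact Fintype.mem_piFinset.2 fun i => Finset.mem_image_of_mem _ hα
    _ = ∏ i, ∑ k ∈ s.image (fun α => α i), u k := (Finset.prod_univ_sum ..).symm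
    _ ≤ _ := Finset.prod_le_prod (fun _ _ => Finset.sum_nonneg fun _ _ => hu0 _)
        fun i _ => hu.sum_le_tsum _ fun _ _ => hu0 _

theorem summable_norm_hermiteCoef_mul (f : 𝓢(EuclideanSpace ℝ (Fin n), ℂ)) :
    Summable fun α : Fin n → ℕ => ‖hermiteCoef α f‖ * hermiteBound α := by
  -- Per variable, two factors `hermiteBound` (one from the statement, one from the crude
  -- coefficient bound for `g`) cost degree 4; two more powers make the series converge.
  obtain ⟨g, hg⟩ := exists_hermiteCoef_eq_prod_pow_mul 6 f
  have hu : Summable fun k : ℕ => 1 / ((k : ℝ) + 1) ^ 2 := by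
    have := (summable_nat_add_iff 1).2 (Real.summable_one_div_nat_pow.2 (one_lt_two))
    simpa using this
  refine Summable.of_nonneg_of_le
    (fun α => mul_nonneg (norm_nonneg _) (hermiteBound_nonneg α)) (fun α => ?_)
    ((summable_prod_of_nonneg (n := n) (fun k => by positivity) hu).mul_left (∫ x, ‖g x‖))
  set P : ℝ := ∏ i, (2 * ((α i : ℝ) + 1)) ^ 6 with hP
  have hPpos : 0 < P := Finset.prod_pos fun i _ => by positivity
  have h1 : P * ‖hermiteCoef α f‖ ≤ hermiteBound α * ∫ x, ‖g x‖ := by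
    refine le_trans (le_of_eq ?_) (norm_hermiteCoef_le α g)
    rw [hg, norm_mul, norm_prod, hP]
    congr 1
    refine Finset.prod_congr rfl fun i _ => ?_
    rw [show (2 * ((α i : ℂ) + 1)) ^ 6 = (((2 * ((α i : ℝ) + 1)) ^ 6 : ℝ) : ℂ) by push_cast; ring,
      Complex.norm_real, Real.norm_of_nonneg (by positivity)]
  have h2 : hermiteBound α * hermiteBound α ≤ P * ∏ i, (1 / ((α i : ℝ) + 1) ^ 2) := by
    rw [hermiteBound, hP, ← Finset.prod_mul_distrib, ← Finset.prod_mul_distrib]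
    refine Finset.prod_le_prod (fun _ _ => by positivity) fun i _ => ?_
    have h0 : (0 : ℝ) ≤ α i := (α i).cast_nonneg
    have h3 : (α i : ℝ) + 2 ≤ 2 * (α i + 1) := by linarith
    calc 2 * ((α i : ℝ) + 2) ^ 2 * (2 * ((α i : ℝ) + 2) ^ 2) = 4 * ((α i : ℝ) + 2) ^ 4 := by ring
      _ ≤ 4 * (2 * ((α i : ℝ) + 1)) ^ 4 := by gcongr
      _ = (2 * ((α i : ℝ) + 1)) ^ 6 * (1 / ((α i : ℝ) + 1) ^ 2) := by
        have : (α i : ℝ) + 1 ≠ 0 := by positivity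
        field_simp
        ring
  have hI : 0 ≤ ∫ x, ‖g x‖ := integral_nonneg fun _ => norm_nonneg _
  refine le_of_mul_le_mul_left ?_ hPpos
  calc P * (‖hermiteCoef α f‖ * hermiteBound α)
      = P * ‖hermiteCoef α f‖ * hermiteBound α := by ring
    _ ≤ hermiteBound α * (∫ x, ‖g x‖) * hermiteBound α :=
        mul_le_mul_of_nonneg_right h1 (hermiteBound_nonneg α)
    _ = (∫ x, ‖g x‖) * (hermiteBound α * hermiteBound α) := by ring
    _ ≤ (∫ x, ‖g x‖) * (P * ∏ i, (1 / ((α i : ℝ) + 1) ^ 2)) := by gcongr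
    _ = _ := by ring

theorem hermiteFun_zero (x : EuclideanSpace ℝ (Fin n)) :
    hermiteFun 0 x = hermiteConst 0 ^ n * Real.exp (-‖x‖ ^ 2 / 2) := by
  rw [hermiteFun_eq_prod, exp_neg_norm_sq_half]
  simp [hermiteLine, hermitePoly, Finset.prod_mul_distrib]

open scoped RealInnerProductSpace in
theorem inner_mul_hermiteFun (ξ x : EuclideanSpace ℝ (Fin n)) (α : Fin n → ℕ) :
    ⟪x, ξ⟫ * hermiteFun α x = ∑ i, ξ i *
      (√(α i / 2) * hermiteFun (Function.update α i (α i - 1)) x +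
      √((α i + 1) / 2) * hermiteFun (Function.update α i (α i + 1)) x) := by
  simp_rw [← coord_mul_hermiteFun, PiLp.inner_apply, Finset.sum_mul]
  refine Finset.sum_congr rfl fun i _ => ?_
  simp; ring

/-! ### Completeness of the Hermite functions -/

section Completeness

variable {u : EuclideanSpace ℝ (Fin n) → ℂ} {C : ℝ}

open scoped RealInnerProductSpace

theorem integrable_hermiteFun_mul_inner_pow_mul (hu : Continuous u) (hC : ∀ x, ‖u x‖ ≤ C)
    (ξ : EuclideanSpace ℝ (Fin n)) (k : ℕ) (α : Fin n → ℕ) :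
    Integrable fun x => (hermiteFun α x : ℂ) * ((⟪x, ξ⟫ : ℝ) : ℂ) ^ k * u x := by
  have hT : (fun x : EuclideanSpace ℝ (Fin n) => (⟪x, ξ⟫ : ℝ) ^ k).HasTemperateGrowth := by
    fun_prop
  have h := (SchwartzMap.smulLeftCLM ℂ (fun x : EuclideanSpace ℝ (Fin n) => (⟪x, ξ⟫ : ℝ) ^ k)
    (hermiteSchwartz α)).integrable (μ := volume)
  have e (x : EuclideanSpace ℝ (Fin n)) : (hermiteFun α x : ℂ) * ((⟪x, ξ⟫ : ℝ) : ℂ) ^ k * u x =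
      u x * SchwartzMap.smulLeftCLM ℂ (fun x : EuclideanSpace ℝ (Fin n) => (⟪x, ξ⟫ : ℝ) ^ k)
    (hermiteSchwartz α) x := by
    rw [SchwartzMap.smulLeftCLM_apply_apply hT, hermiteSchwartz_apply, Complex.real_smul]
    push_cast
    ring
  simp_rw [e]
  exact h.bdd_mul hu.aestronglyMeasurable (ae_of_all _ hC)

/-- Multiplying `h_α` by `⟪x, ξ⟫` gives a finite combination of Hermite functions, so the induction
on `k` must run over all `α` at once. -/
theorem integral_hermiteFun_mul_inner_pow_mul (hu : Continuous u) (hC : ∀ x, ‖u x‖ ≤ C)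
    (h0 : ∀ α, hermiteCoef α u = 0) (ξ : EuclideanSpace ℝ (Fin n)) (k : ℕ) (α : Fin n → ℕ) :
    ∫ x, (hermiteFun α x : ℂ) * ((⟪x, ξ⟫ : ℝ) : ℂ) ^ k * u x = 0 := by
  induction k generalizing α with
  | zero => simpa [hermiteCoef] using h0 α
  | succ k ih =>
    have e (x : EuclideanSpace ℝ (Fin n)) :
        (hermiteFun α x : ℂ) * ((⟪x, ξ⟫ : ℝ) : ℂ) ^ (k + 1) * u x = ∑ i, (ξ i : ℂ) *
        ((√(α i / 2) : ℂ) * ((hermiteFun (Function.update α i (α i - 1)) x : ℂ) *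
          ((⟪x, ξ⟫ : ℝ) : ℂ) ^ k * u x) +
        (√((α i + 1) / 2) : ℂ) * ((hermiteFun (Function.update α i (α i + 1)) x : ℂ) *
          ((⟪x, ξ⟫ : ℝ) : ℂ) ^ k * u x)) := by
      have h1 := congrArg (fun r : ℝ => (r : ℂ)) (inner_mul_hermiteFun ξ x α)
      push_cast at h1
      calc _ = (((⟪x, ξ⟫ : ℝ) : ℂ) * (hermiteFun α x : ℂ)) * (((⟪x, ξ⟫ : ℝ) : ℂ) ^ k * u x) := by
            ring
        _ = _ := by
            rw [h1, Finset.sum_mul]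
            exact Finset.sum_congr rfl fun i _ => by ring
    have hi (β : Fin n → ℕ) := integrable_hermiteFun_mul_inner_pow_mul hu hC ξ k β
    simp_rw [e]
    rw [integral_finsetSum _ (by
      intro i _
      exact (((hi _).const_mul _).add ((hi _).const_mul _)).const_mul _)]
    refine Finset.sum_eq_zero fun i _ => ?_
    rw [integral_const_mul, integral_add ((hi _).const_mul _) ((hi _).const_mul _),
      integral_const_mul, integral_const_mul, ih, ih]
    simp

theorem integrable_exp_mul_norm_mul_gaussian (b : ℝ) :
    Integrable fun x : EuclideanSpace ℝ (Fin n) =>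
      Real.exp (b * ‖x‖) * Real.exp (-‖x‖ ^ 2 / 2) := by
  -- The dominating function comes from `b r - r²/2 ≤ b² - r²/4`, that is `(b - r/2)² ≥ 0`.
  have h := (GaussianFourier.integrable_cexp_neg_mul_sq_norm_add_of_euclideanSpace
    (ι := Fin n) (b := 1 / 4) (by norm_num) 0 0).norm.const_mul (Real.exp (b ^ 2))
  refine h.mono' (by fun_prop) (ae_of_all _ fun x => ?_)
  rw [← Real.exp_add, Real.norm_of_nonneg (Real.exp_pos _).le, Complex.norm_exp, ← Real.exp_add]
  refine Real.exp_le_exp.2 ?_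
  have : (-(1 / 4 : ℂ) * (‖x‖ : ℂ) ^ 2 + 0 * ((⟪(0 : EuclideanSpace ℝ (Fin n)), x⟫ : ℝ) : ℂ)).re =
      -(1 / 4) * ‖x‖ ^ 2 := by
    rw [show (-(1 / 4 : ℂ) * (‖x‖ : ℂ) ^ 2 +
      0 * ((⟪(0 : EuclideanSpace ℝ (Fin n)), x⟫ : ℝ) : ℂ)) =
      ((-(1 / 4) * ‖x‖ ^ 2 : ℝ) : ℂ) by push_cast; ring, Complex.ofReal_re]
  rw [this]
  nlinarith [sq_nonneg (b - ‖x‖ / 2)]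

/-- A bounded continuous function orthogonal to all Hermite functions vanishes. -/
theorem eq_zero_of_hermiteCoef_eq_zero (hu : Continuous u) (hC : ∀ x, ‖u x‖ ≤ C)
    (h0 : ∀ α, hermiteCoef α u = 0) : u = 0 := by
  -- The factor `h_0` is a positive Gaussian. It makes the exponential series in the Fourier
  -- integral integrable term by term, and every term is a vanishing moment.
  set F : EuclideanSpace ℝ (Fin n) → ℂ := fun x => (hermiteFun 0 x : ℂ) * u x with hF
  have hFc : Continuous F := (continuous_ofReal_hermiteFun 0).mul hu
  have hFi : Integrable F := by
    simpa using integrable_hermiteFun_mul_inner_pow_mul hu hC 0 0 0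
  have hfour : FourierTransform.fourier F = 0 := by
    funext ξ
    rw [Real.fourier_eq']
    have hs : HasSum (fun k : ℕ => ∫ x, (-2 * Real.pi * Complex.I : ℂ) ^ k / (k ! : ℂ) *
        ((hermiteFun 0 x : ℂ) * ((⟪x, ξ⟫ : ℝ) : ℂ) ^ k * u x))
        (∫ x, Complex.exp (((-2 * Real.pi * ⟪x, ξ⟫ : ℝ) : ℂ) * Complex.I) • F x) := by
      have hsum (x : EuclideanSpace ℝ (Fin n)) :
          HasSum (fun k : ℕ => (2 * Real.pi * |⟪x, ξ⟫|) ^ k / k ! * (|hermiteFun 0 x| * C))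
            (Real.exp (2 * Real.pi * |⟪x, ξ⟫|) * (|hermiteFun 0 x| * C)) := by
        have := NormedSpace.expSeries_div_hasSum_exp (2 * Real.pi * |⟪x, ξ⟫|)
        rw [← Real.exp_eq_exp_ℝ] at this
        exact this.mul_right _
      refine hasSum_integral_of_dominated_convergence
        (fun k x => (2 * Real.pi * |⟪x, ξ⟫|) ^ k / k ! * (|hermiteFun 0 x| * C))
        (fun k => ((integrable_hermiteFun_mul_inner_pow_mul hu hC ξ k 0).const_mul
          _).aestronglyMeasurable) (fun k => ae_of_all _ fun x => ?_)
        (ae_of_all _ fun x => (hsum x).summable) ?_ (ae_of_all _ fun x => ?_)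
      · have hpi : ‖(-2 * Real.pi * Complex.I : ℂ)‖ = 2 * Real.pi := by
          simp [abs_of_pos Real.pi_pos]
        rw [norm_mul, norm_div, norm_pow, hpi, norm_mul, norm_mul, norm_pow, Complex.norm_real,
          Complex.norm_real, Complex.norm_natCast, Real.norm_eq_abs, Real.norm_eq_abs]
        calc _ = (2 * Real.pi) ^ k * |⟪x, ξ⟫| ^ k / k ! * (|hermiteFun 0 x| * ‖u x‖) := by ring
          _ ≤ _ := by
            have := Real.pi_pos
            rw [mul_pow (2 * Real.pi)]
            gcongr
            exact hC x
      · simp_rw [fun x => (hsum x).tsum_eq]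
        have hC0 : 0 ≤ C := (norm_nonneg _).trans (hC 0)
        have hc0 := pow_pos (hermiteConst_pos 0) n
        refine ((integrable_exp_mul_norm_mul_gaussian (2 * Real.pi * ‖ξ‖)).const_mul
          (hermiteConst 0 ^ n * C)).mono' ?_ (ae_of_all _ fun x => ?_)
        · have := continuous_hermiteFun (0 : Fin n → ℕ)
          exact Continuous.aestronglyMeasurable (by fun_prop)
        · rw [Real.norm_of_nonneg (by positivity), hermiteFun_zero,
            abs_of_pos (mul_pos hc0 (Real.exp_pos _))]
          have h1 : |⟪x, ξ⟫| ≤ ‖x‖ * ‖ξ‖ := abs_real_inner_le_norm x ξ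
          have h2 : 2 * Real.pi * |⟪x, ξ⟫| ≤ 2 * Real.pi * ‖ξ‖ * ‖x‖ := by
            have := Real.pi_pos
            calc _ ≤ 2 * Real.pi * (‖x‖ * ‖ξ‖) := by gcongr
              _ = _ := by ring
          calc _ ≤ Real.exp (2 * Real.pi * ‖ξ‖ * ‖x‖) *
                (hermiteConst 0 ^ n * Real.exp (-‖x‖ ^ 2 / 2) * C) := by gcongr
            _ = _ := by ring
      · have := (NormedSpace.expSeries_div_hasSum_exp
          (((-2 * Real.pi * ⟪x, ξ⟫ : ℝ) : ℂ) * Complex.I)).mul_right (F x)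
        rw [← Complex.exp_eq_exp_ℂ] at this
        refine this.congr_fun fun k => ?_
        simp only [hF]
        push_cast
        rw [mul_right_comm (-2 * (Real.pi : ℂ)), mul_pow _ ((⟪x, ξ⟫ : ℝ) : ℂ)]
        ring
    refine hs.unique ?_
    simp_rw [integral_const_mul, integral_hermiteFun_mul_inner_pow_mul hu hC h0 ξ]
    simp
  have hF0 : F = 0 := by
    rw [← hFc.fourierInv_fourier_eq hFi (by rw [hfour]; exact integrable_zero _ _ _), hfour]
    funext v
    rw [Real.fourierInv_eq]
    simp
  funext x
  have h1 := congrFun hF0 x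
  have h2 : hermiteFun (0 : Fin n → ℕ) x ≠ 0 := by
    rw [hermiteFun_zero]
    have := pow_pos (hermiteConst_pos 0) n
    positivity
  simpa [hF, h2] using h1

end Completeness

/-- The Hermite expansion of a Schwartz function converges pointwise. -/
theorem hasSum_hermiteCoef_mul_hermiteFun (f : 𝓢(EuclideanSpace ℝ (Fin n), ℂ))
    (x : EuclideanSpace ℝ (Fin n)) :
    HasSum (fun α : Fin n → ℕ => hermiteCoef α f * (hermiteFun α x : ℂ)) (f x) := by
  have hsum := summable_norm_hermiteCoef_mul f
  have hb (α : Fin n → ℕ) (x : EuclideanSpace ℝ (Fin n)) :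
      ‖hermiteCoef α f * (hermiteFun α x : ℂ)‖ ≤ ‖hermiteCoef α f‖ * hermiteBound α := by
    rw [norm_mul]
    gcongr
    simpa using abs_hermiteFun_le α x
  -- The series converges uniformly to a bounded continuous `g`. Its coefficients equal those of
  -- `f`, so completeness applied to `f - g` gives `g = f`.
  set g : EuclideanSpace ℝ (Fin n) → ℂ := fun x =>
    ∑' α : Fin n → ℕ, hermiteCoef α f * (hermiteFun α x : ℂ) with hg
  have hgc : Continuous g := continuous_tsum
    (fun α => continuous_const.mul (continuous_ofReal_hermiteFun α)) hsum hb
  have hgb (x : EuclideanSpace ℝ (Fin n)) :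
      ‖g x‖ ≤ ∑' α : Fin n → ℕ, ‖hermiteCoef α f‖ * hermiteBound α :=
    tsum_of_norm_bounded hsum.hasSum fun α => hb α x
  have hgi (β : Fin n → ℕ) : Integrable fun x => (hermiteFun β x : ℂ) * g x := by
    simp_rw [mul_comm _ (g _)]
    exact (integrable_hermiteFun β).bdd_mul hgc.aestronglyMeasurable (ae_of_all _ hgb)
  have hgcoef (β : Fin n → ℕ) : hermiteCoef β g = hermiteCoef β f := by
    have hint (α : Fin n → ℕ) : Integrable fun x : EuclideanSpace ℝ (Fin n) =>
        (hermiteFun β x : ℂ) * (hermiteCoef α f * (hermiteFun α x : ℂ)) :=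
      integrable_hermiteFun_mul β ((integrable_hermiteFun α).const_mul _)
    have hs := hasSum_integral_of_summable_integral_norm hint (by
      refine Summable.of_nonneg_of_le (fun α => integral_nonneg fun _ => norm_nonneg _)
        (fun α => ?_) (hsum.mul_right
          (∫ x : EuclideanSpace ℝ (Fin n), ‖(hermiteFun β x : ℂ)‖))
      rw [← integral_const_mul]
      refine integral_mono (hint α).norm ((integrable_hermiteFun β).norm.const_mul _) fun x => ?_
      dsimp only
      rw [norm_mul, mul_comm]
      gcongr
      exact hb α x)
    simp_rw [tsum_mul_left] at hs
    have hval (α : Fin n → ℕ) : ∫ x : EuclideanSpace ℝ (Fin n),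
        (hermiteFun β x : ℂ) * (hermiteCoef α f * (hermiteFun α x : ℂ)) =
        if α = β then hermiteCoef β f else 0 := by
      simp_rw [mul_left_comm _ (hermiteCoef α f)]
      rw [integral_const_mul, ← hermiteCoef, hermiteCoef_hermiteFun]
      by_cases h : α = β
      · subst h; simp
      · simp [h, Ne.symm h]
    simp_rw [hval] at hs
    exact hs.unique (hasSum_ite_eq β (hermiteCoef β f))
  have hu : (fun x => f x - g x) = 0 := by
    obtain ⟨C, hC⟩ : ∃ C, ∀ x, ‖f x‖ ≤ C := ⟨_, fun x => f.norm_le_seminorm ℂ x⟩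
    refine eq_zero_of_hermiteCoef_eq_zero (f.continuous.sub hgc)
      (fun x => (norm_sub_le _ _).trans (add_le_add (hC x) (hgb x))) fun β => ?_
    simp only [hermiteCoef, mul_sub]
    rw [integral_sub (integrable_hermiteFun_mul β f.integrable) (hgi β), sub_eq_zero]
    exact (hgcoef β).symm
  have hfg : f x = g x := sub_eq_zero.1 (congrFun hu x)
  rw [hfg]
  exact (Summable.of_norm_bounded hsum fun α => hb α x).hasSum

/-! ### Homogeneous kernels and polar coordinates -/

/-- A function on `ℝⁿ` that is continuous and homogeneous of degree `0` away from the origin and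
has mean zero on the unit sphere. -/
structure IsMeanZeroKernel (K : EuclideanSpace ℝ (Fin n) → ℂ) : Prop where
  continuousOn : ContinuousOn K {0}ᶜ
  hom : ∀ (r : ℝ) (x : EuclideanSpace ℝ (Fin n)), 0 < r → x ≠ 0 → K (r • x) = K x
  mean : ∫ u : Metric.sphere (0 : EuclideanSpace ℝ (Fin n)) 1, K u
      ∂(volume : Measure (EuclideanSpace ℝ (Fin n))).toSphere = 0

/-- Integration in polar coordinates of a product of an angular and a radial function. -/
theorem integral_eq_sphere_mul_radial [Nontrivial (EuclideanSpace ℝ (Fin n))]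
    (F A : EuclideanSpace ℝ (Fin n) → ℂ) (ρ : ℝ → ℂ)
    (hF : ∀ x ≠ 0, F x = A (‖x‖⁻¹ • x) * ρ ‖x‖) :
    ∫ x, F x = (∫ u : Metric.sphere (0 : EuclideanSpace ℝ (Fin n)) 1, A u
      ∂(volume : Measure (EuclideanSpace ℝ (Fin n))).toSphere) *
      ∫ r in Set.Ioi (0 : ℝ), (r : ℂ) ^ (n - 1) * ρ r := by
  set μ : Measure (EuclideanSpace ℝ (Fin n)) := volume with hμ
  have hdim : Module.finrank ℝ (EuclideanSpace ℝ (Fin n)) = n := finrank_euclideanSpace_fin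
  have hp := μ.measurePreserving_homeomorphUnitSphereProd
  rw [hdim] at hp
  calc ∫ x, F x ∂μ = ∫ x : ({0}ᶜ : Set (EuclideanSpace ℝ (Fin n))), F x ∂(μ.comap (↑)) := by
        rw [integral_subtype_comap (measurableSet_singleton _).compl F,
          restrict_compl_singleton]
    _ = ∫ p : Metric.sphere (0 : EuclideanSpace ℝ (Fin n)) 1 × Set.Ioi (0 : ℝ),
          A p.1 * ρ p.2 ∂μ.toSphere.prod (.volumeIoiPow (n - 1)) := by
        rw [← hp.integral_comp (Homeomorph.measurableEmbedding _)]
        refine integral_congr_ae (ae_of_all _ fun x => ?_)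
        simpa using hF x x.2
    _ = (∫ u, A u ∂μ.toSphere) * ∫ r : Set.Ioi (0 : ℝ), ρ r ∂.volumeIoiPow (n - 1) :=
        integral_prod_mul (fun u : Metric.sphere (0 : EuclideanSpace ℝ (Fin n)) 1 => A u)
          (fun r : Set.Ioi (0 : ℝ) => ρ r)
    _ = _ := by
        congr 1
        simp only [Measure.volumeIoiPow, ENNReal.ofReal]
        rw [integral_withDensity_eq_integral_smul,
          integral_subtype_comap measurableSet_Ioi fun a ↦ Real.toNNReal (a ^ (n - 1)) • ρ a,
          setIntegral_congr_fun measurableSet_Ioi fun x hx ↦ ?_]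
        · rw [NNReal.smul_def, Real.coe_toNNReal _ (pow_nonneg hx.out.le _), Complex.real_smul]
          push_cast
          rfl
        · exact (measurable_subtype_coe.pow_const _).real_toNNReal

theorem IsMeanZeroKernel.map_inv_norm_smul {K : EuclideanSpace ℝ (Fin n) → ℂ}
    (hK : IsMeanZeroKernel K) {x : EuclideanSpace ℝ (Fin n)} (hx : x ≠ 0) :
    K (‖x‖⁻¹ • x) = K x :=
  hK.hom _ _ (inv_pos.2 (norm_pos_iff.2 hx)) hx

theorem IsMeanZeroKernel.exists_bound {K : EuclideanSpace ℝ (Fin n) → ℂ}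
    (hK : IsMeanZeroKernel K) : ∃ C, 0 ≤ C ∧ ∀ x ≠ 0, ‖K x‖ ≤ C := by
  obtain ⟨C, hC⟩ := (isCompact_sphere (0 : EuclideanSpace ℝ (Fin n)) 1).exists_bound_of_continuousOn
    (hK.continuousOn.mono fun x hx => by
      rintro rfl
      simp at hx)
  refine ⟨max C 0, le_max_right _ _, fun x hx => ?_⟩
  rw [← hK.map_inv_norm_smul hx]
  refine (hC _ ?_).trans (le_max_left _ _)
  have := norm_pos_iff.2 hx
  simp [norm_smul, this.ne']

/-- The singular kernel `K(x)/|x|ⁿ`. -/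
noncomputable def singularKernel (K : EuclideanSpace ℝ (Fin n) → ℂ)
    (x : EuclideanSpace ℝ (Fin n)) : ℂ :=
  K x / (‖x‖ : ℂ) ^ n

theorem IsMeanZeroKernel.aestronglyMeasurable_singularKernel
    [Nontrivial (EuclideanSpace ℝ (Fin n))] {K : EuclideanSpace ℝ (Fin n) → ℂ}
    (hK : IsMeanZeroKernel K) : AEStronglyMeasurable (singularKernel K) := by
  rw [← restrict_compl_singleton (μ := volume) (0 : EuclideanSpace ℝ (Fin n))]
  refine ContinuousOn.aestronglyMeasurable (hK.continuousOn.div ?_ fun x hx => ?_)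
    (measurableSet_singleton _).compl
  · exact Continuous.continuousOn (by fun_prop)
  · exact pow_ne_zero _ (Complex.ofReal_ne_zero.2 (norm_ne_zero_iff.2 hx))

theorem ae_ne_zero [Nontrivial (EuclideanSpace ℝ (Fin n))] :
    ∀ᵐ x : EuclideanSpace ℝ (Fin n), x ≠ 0 := by
  rw [ae_iff]
  simp

/-! ### Regularization of the singular integral -/

/-- The integrable function that dominates the regularized kernel. -/
noncomputable def regularWeight (x : EuclideanSpace ℝ (Fin n)) : ℝ :=
  min ‖x‖ ‖x‖⁻¹ / ‖x‖ ^ n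

theorem regularWeight_nonneg (x : EuclideanSpace ℝ (Fin n)) : 0 ≤ regularWeight x := by
  unfold regularWeight
  positivity

theorem integrable_regularWeight [Nontrivial (EuclideanSpace ℝ (Fin n))] :
    Integrable (regularWeight (n := n)) := by
  have hn : 0 < n := by
    have := Module.finrank_pos (R := ℝ) (M := EuclideanSpace ℝ (Fin n))
    rwa [finrank_euclideanSpace_fin] at this
  refine (integrable_fun_norm_addHaar volume (f := fun r : ℝ => min r r⁻¹ / r ^ n)).2 ?_
  rw [finrank_euclideanSpace_fin]
  refine (integrable_inv_one_add_sq.const_mul 2).integrableOn.mono'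
    (Measurable.aestronglyMeasurable (by fun_prop)) ?_
  filter_upwards [ae_restrict_mem measurableSet_Ioi] with r hr
  have hr : 0 < r := hr
  -- The polar Jacobian cancels all but one power of `r`; what is left is `1` for `r ≤ 1` and `r⁻²`
  -- for `r ≥ 1`, both at most `2 / (1 + r²)`.
  have e : r ^ (n - 1) • (min r r⁻¹ / r ^ n) = min r r⁻¹ / r := by
    obtain ⟨m, rfl⟩ := Nat.exists_eq_add_of_le' hn
    rw [Nat.add_sub_cancel, pow_succ, smul_eq_mul]
    field_simp
  rw [e, Real.norm_of_nonneg (by positivity), div_le_iff₀ hr, ← div_eq_mul_inv]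
  rcases le_total r 1 with h | h
  · refine (min_le_left _ _).trans ?_
    have h1 : r ^ 2 ≤ 1 := pow_le_one₀ hr.le h
    rw [div_mul_eq_mul_div, le_div_iff₀ (by positivity)]
    nlinarith
  · refine (min_le_right _ _).trans ?_
    rw [inv_le_iff_one_le_mul₀ hr, div_mul_eq_mul_div, div_mul_eq_mul_div,
      le_div_iff₀ (by positivity)]
    nlinarith

open Classical in
/-- The function `f` with its value at the origin subtracted on the unit ball. -/
noncomputable def regularize (f : EuclideanSpace ℝ (Fin n) → ℂ)
    (x : EuclideanSpace ℝ (Fin n)) : ℂ :=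
  f x - if ‖x‖ ≤ 1 then f 0 else 0

/-- The principal value functional as an absolutely convergent integral. -/
noncomputable def pvIntegral (K f : EuclideanSpace ℝ (Fin n) → ℂ) : ℂ :=
  ∫ x, singularKernel K x * regularize f x

section Bounds

variable {K f : EuclideanSpace ℝ (Fin n) → ℂ} {C L : ℝ}

/-- The Lipschitz bound at the origin is used inside the unit ball and the decay bound outside; the
minimum in `regularWeight` records the two cases. -/
theorem norm_singularKernel_mul_regularize_le (hC : ∀ x ≠ 0, ‖K x‖ ≤ C)
    (h1 : ∀ x, ‖f x - f 0‖ ≤ L * ‖x‖) (h2 : ∀ x, ‖x‖ * ‖f x‖ ≤ L)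
    {x : EuclideanSpace ℝ (Fin n)} (hx : x ≠ 0) :
    ‖singularKernel K x * regularize f x‖ ≤ C * L * regularWeight x := by
  have hx0 := norm_pos_iff.2 hx
  have hC0 : 0 ≤ C := (norm_nonneg _).trans (hC x hx)
  have hreg : ‖regularize f x‖ ≤ L * min ‖x‖ ‖x‖⁻¹ := by
    unfold regularize
    split_ifs with h
    · rw [min_eq_left (h.trans ((one_le_inv₀ hx0).2 h))]
      exact h1 x
    · have h' : 1 ≤ ‖x‖ := (not_le.1 h).le
      rw [min_eq_right ((inv_le_one_of_one_le₀ h').trans h'), sub_zero, ← div_eq_mul_inv,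
        le_div_iff₀ hx0, mul_comm]
      exact h2 x
  rw [norm_mul, singularKernel, norm_div, norm_pow, Complex.norm_real, norm_norm, regularWeight]
  calc ‖K x‖ / ‖x‖ ^ n * ‖regularize f x‖ ≤ C / ‖x‖ ^ n * (L * min ‖x‖ ‖x‖⁻¹) := by
        gcongr
        exact hC x hx
    _ = _ := by ring

theorem measurable_regularize (hf : Continuous f) : Measurable (regularize f) := by
  classical
  refine hf.measurable.sub (Measurable.ite ?_ measurable_const measurable_const)
  exact measurableSet_le measurable_norm measurable_const

variable [Nontrivial (EuclideanSpace ℝ (Fin n))]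

theorem IsMeanZeroKernel.aestronglyMeasurable_mul_regularize (hK : IsMeanZeroKernel K)
    (hf : Continuous f) :
    AEStronglyMeasurable fun x => singularKernel K x * regularize f x :=
  hK.aestronglyMeasurable_singularKernel.mul (measurable_regularize hf).aestronglyMeasurable

theorem IsMeanZeroKernel.integrable_mul_regularize (hK : IsMeanZeroKernel K) (hf : Continuous f)
    (h1 : ∀ x, ‖f x - f 0‖ ≤ L * ‖x‖) (h2 : ∀ x, ‖x‖ * ‖f x‖ ≤ L) :
    Integrable fun x => singularKernel K x * regularize f x := by
  obtain ⟨C, _, hC⟩ := hK.exists_bound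
  refine (integrable_regularWeight.const_mul (C * L)).mono'
    (hK.aestronglyMeasurable_mul_regularize hf) ?_
  filter_upwards [ae_ne_zero] with x hx
  exact norm_singularKernel_mul_regularize_le hC h1 h2 hx

theorem integral_norm_mul_regularize_le (hC : ∀ x ≠ 0, ‖K x‖ ≤ C)
    (h1 : ∀ x, ‖f x - f 0‖ ≤ L * ‖x‖) (h2 : ∀ x, ‖x‖ * ‖f x‖ ≤ L) :
    ∫ x, ‖singularKernel K x * regularize f x‖ ≤
      C * L * ∫ x : EuclideanSpace ℝ (Fin n), regularWeight x := by
  rw [← integral_const_mul]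
  refine integral_mono_of_nonneg (ae_of_all _ fun _ => norm_nonneg _)
    (integrable_regularWeight.const_mul _) ?_
  filter_upwards [ae_ne_zero] with x hx
  exact norm_singularKernel_mul_regularize_le hC h1 h2 hx

end Bounds

/-- The Schwartz seminorm that controls the principal value functional. -/
noncomputable def pvSeminorm (f : 𝓢(EuclideanSpace ℝ (Fin n), ℂ)) : ℝ :=
  ((Finset.Iic (1, 1)).sup (schwartzSeminormFamily ℂ (EuclideanSpace ℝ (Fin n)) ℂ)) f

theorem seminorm_le_pvSeminorm {k m : ℕ} (hk : k ≤ 1) (hm : m ≤ 1)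
    (f : 𝓢(EuclideanSpace ℝ (Fin n), ℂ)) : SchwartzMap.seminorm ℂ k m f ≤ pvSeminorm f := by
  have h : (k, m) ∈ Finset.Iic (1, 1) := by simp [hk, hm]
  exact Seminorm.le_def.1 (Finset.le_sup
    (f := schwartzSeminormFamily ℂ (EuclideanSpace ℝ (Fin n)) ℂ) h) f

theorem norm_sub_le_pvSeminorm (f : 𝓢(EuclideanSpace ℝ (Fin n), ℂ))
    (x : EuclideanSpace ℝ (Fin n)) : ‖f x - f 0‖ ≤ pvSeminorm f * ‖x‖ := by
  have := Convex.norm_image_sub_le_of_norm_fderiv_le (𝕜 := ℝ) (s := Set.univ) (f := f)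
    (C := pvSeminorm f) (fun x _ => f.differentiableAt) (fun x _ => by
      have h := f.norm_iteratedFDeriv_le_seminorm ℂ 1 x
      rw [norm_iteratedFDeriv_one] at h
      exact h.trans (seminorm_le_pvSeminorm zero_le_one le_rfl f)) convex_univ
      (Set.mem_univ 0) (Set.mem_univ x)
  simpa using this

theorem norm_mul_norm_le_pvSeminorm (f : 𝓢(EuclideanSpace ℝ (Fin n), ℂ))
    (x : EuclideanSpace ℝ (Fin n)) : ‖x‖ * ‖f x‖ ≤ pvSeminorm f := by
  have h := f.norm_pow_mul_le_seminorm ℂ 1 x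
  rw [pow_one] at h
  exact h.trans (seminorm_le_pvSeminorm le_rfl zero_le_one f)

theorem measurableSet_lt_norm (ε : ℝ) :
    MeasurableSet {x : EuclideanSpace ℝ (Fin n) | ε < ‖x‖} :=
  measurableSet_lt measurable_const measurable_norm

/-! ### The principal value distribution and its termwise action -/

section PrincipalValue

variable [Nontrivial (EuclideanSpace ℝ (Fin n))] {K : EuclideanSpace ℝ (Fin n) → ℂ}

theorem IsMeanZeroKernel.integrable_mul_regularize_schwartz (hK : IsMeanZeroKernel K)
    (f : 𝓢(EuclideanSpace ℝ (Fin n), ℂ)) :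
    Integrable fun x => singularKernel K x * regularize f x :=
  hK.integrable_mul_regularize f.continuous (norm_sub_le_pvSeminorm f)
    (norm_mul_norm_le_pvSeminorm f)

/-- The principal value distribution `vp K(x)/|x|ⁿ`. -/
noncomputable def IsMeanZeroKernel.principalValue (hK : IsMeanZeroKernel K) :
    𝓢'(EuclideanSpace ℝ (Fin n), ℂ) :=
  ContinuousLinearMap.toPointwiseConvergenceCLM _ _ _ _ <|
    SchwartzMap.mkCLMtoNormedSpace (𝕜 := ℂ) (σ := RingHom.id ℂ) (fun f => pvIntegral K f)
      (fun f g => by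
        rw [pvIntegral, pvIntegral, pvIntegral,
          ← integral_add (hK.integrable_mul_regularize_schwartz f)
            (hK.integrable_mul_regularize_schwartz g)]
        refine integral_congr_ae (ae_of_all _ fun x => ?_)
        simp only [regularize, add_apply]
        split_ifs <;> ring)
      (fun c f => by
        rw [pvIntegral, pvIntegral, RingHom.id_apply, smul_eq_mul, ← integral_const_mul]
        refine integral_congr_ae (ae_of_all _ fun x => ?_)
        simp only [regularize, smul_apply, smul_eq_mul]
        split_ifs <;> ring)
      (by
        obtain ⟨C, hC0, hC⟩ := hK.exists_bound
        refine ⟨Finset.Iic (1, 1), C * ∫ x : EuclideanSpace ℝ (Fin n), regularWeight x,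
          mul_nonneg hC0 (integral_nonneg regularWeight_nonneg), fun f => ?_⟩
        refine (norm_integral_le_integral_norm _).trans
          ((integral_norm_mul_regularize_le hC (norm_sub_le_pvSeminorm f)
            (norm_mul_norm_le_pvSeminorm f)).trans (le_of_eq ?_))
        rw [pvSeminorm]
        ring)

theorem IsMeanZeroKernel.principalValue_apply (hK : IsMeanZeroKernel K)
    (f : 𝓢(EuclideanSpace ℝ (Fin n), ℂ)) : hK.principalValue f = pvIntegral K f := rfl

/-- The angular factor is the mean of `K`. No integrability of `ρ` is needed, because the polar
product formula also holds with the default value `0` of divergent integrals. -/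
theorem IsMeanZeroKernel.integral_mul_radial (hK : IsMeanZeroKernel K) (ρ : ℝ → ℂ) :
    ∫ x : EuclideanSpace ℝ (Fin n), singularKernel K x * ρ ‖x‖ = 0 := by
  rw [integral_eq_sphere_mul_radial _ K (fun r => (1 / (r : ℂ) ^ n) * ρ r) fun x hx => by
    rw [hK.map_inv_norm_smul hx, singularKernel]
    ring]
  rw [hK.mean, zero_mul]

theorem IsMeanZeroKernel.integrableOn_singularKernel_mul (hK : IsMeanZeroKernel K)
    (f : 𝓢(EuclideanSpace ℝ (Fin n), ℂ)) {ε : ℝ} (hε : 0 < ε) :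
    IntegrableOn (fun x => singularKernel K x * f x) {x | ε < ‖x‖} := by
  obtain ⟨C, hC0, hC⟩ := hK.exists_bound
  refine Integrable.bdd_mul (c := C / ε ^ n) f.integrable.integrableOn
    hK.aestronglyMeasurable_singularKernel.restrict ?_
  filter_upwards [ae_restrict_mem (measurableSet_lt_norm ε)] with x hx
  have hx : ε < ‖x‖ := hx
  rw [singularKernel, norm_div, norm_pow, Complex.norm_real, norm_norm]
  have := hC x (norm_pos_iff.1 (hε.trans hx))
  gcongr

theorem IsMeanZeroKernel.setIntegral_singularKernel_mul (hK : IsMeanZeroKernel K)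
    (f : 𝓢(EuclideanSpace ℝ (Fin n), ℂ)) {ε : ℝ} (hε : 0 < ε) :
    ∫ x in {x | ε < ‖x‖}, singularKernel K x * f x =
      ∫ x in {x | ε < ‖x‖}, singularKernel K x * regularize f x := by
  classical
  rw [← sub_eq_zero, ← integral_sub (hK.integrableOn_singularKernel_mul f hε)
    (hK.integrable_mul_regularize_schwartz f).integrableOn,
    ← integral_indicator (measurableSet_lt_norm ε)]
  -- The two integrands differ by the kernel times a radial function, `f 0` on `ε < |x| ≤ 1`.
  rw [← hK.integral_mul_radial
    fun r => if ε < r then (if r ≤ 1 then f 0 else 0) else 0]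
  refine integral_congr_ae (ae_of_all _ fun x => ?_)
  by_cases hx : ε < ‖x‖
  · simp [Set.indicator, hx, regularize]
    split_ifs <;> ring
  · simp [Set.indicator, hx]

theorem IsMeanZeroKernel.isPrincipalValue (hK : IsMeanZeroKernel K) :
    IsPrincipalValue K hK.principalValue := by
  intro f
  refine ⟨fun ε hε => hK.integrableOn_singularKernel_mul f hε, ?_⟩
  have h1 : Tendsto (fun ε : ℝ => ∫ x, {x : EuclideanSpace ℝ (Fin n) | ε < ‖x‖}.indicator
      (fun x => singularKernel K x * regularize f x) x) (𝓝[>] 0)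
      (𝓝 (hK.principalValue f)) := by
    refine tendsto_integral_filter_of_dominated_convergence _
      (Eventually.of_forall fun ε => (hK.aestronglyMeasurable_mul_regularize
        f.continuous).indicator (measurableSet_lt_norm ε))
      (Eventually.of_forall fun ε => ae_of_all _ fun x => norm_indicator_le_norm_self _ _)
      (hK.integrable_mul_regularize_schwartz f).norm ?_
    filter_upwards [ae_ne_zero] with x hx
    -- For fixed `x ≠ 0` the truncation is inactive as soon as `ε < |x|`.
    refine tendsto_const_nhds.congr' ?_
    filter_upwards [Ioo_mem_nhdsGT (norm_pos_iff.2 hx)] with ε hε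
    rw [Set.indicator_of_mem]
    exact hε.2
  refine h1.congr' ?_
  filter_upwards [self_mem_nhdsWithin] with ε hε
  rw [integral_indicator (measurableSet_lt_norm ε)]
  exact (hK.setIntegral_singularKernel_mul f hε).symm

/-- The principal value functional may be applied termwise to a Hermite expansion. -/
theorem IsMeanZeroKernel.hasSum_hermiteCoef_mul_pvIntegral (hK : IsMeanZeroKernel K)
    (f : 𝓢(EuclideanSpace ℝ (Fin n), ℂ)) :
    HasSum (fun α : Fin n → ℕ => hermiteCoef α f * hK.principalValue (hermiteSchwartz α))
      (hK.principalValue f) := by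
  obtain ⟨C, hC0, hC⟩ := hK.exists_bound
  have hreg (α : Fin n → ℕ) (x : EuclideanSpace ℝ (Fin n)) : singularKernel K x *
      regularize (hermiteSchwartz α) x =
      singularKernel K x * regularize (fun x => (hermiteFun α x : ℂ)) x := by
    simp only [regularize, hermiteSchwartz_apply]
  have hb1 (α : Fin n → ℕ) (x : EuclideanSpace ℝ (Fin n)) :
      ‖(hermiteFun α x : ℂ) - (hermiteFun α 0 : ℂ)‖ ≤ n * hermiteBound α * ‖x‖ := by
    rw [← Complex.ofReal_sub, Complex.norm_real]
    exact abs_hermiteFun_sub_le α x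
  have hb2 (α : Fin n → ℕ) (x : EuclideanSpace ℝ (Fin n)) :
      ‖x‖ * ‖(hermiteFun α x : ℂ)‖ ≤ n * hermiteBound α := by
    rw [Complex.norm_real]
    exact norm_mul_abs_hermiteFun_le α x
  have hint (α : Fin n → ℕ) : Integrable fun x => hermiteCoef α f *
      (singularKernel K x * regularize (fun x => (hermiteFun α x : ℂ)) x) :=
    (hK.integrable_mul_regularize (continuous_ofReal_hermiteFun α) (hb1 α)
      (hb2 α)).const_mul _
  have hs := hasSum_integral_of_summable_integral_norm hint (by
    refine Summable.of_nonneg_of_le (fun α => integral_nonneg fun _ => norm_nonneg _)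
      (fun α => ?_) ((summable_norm_hermiteCoef_mul f).mul_right
        (C * n * ∫ x : EuclideanSpace ℝ (Fin n), regularWeight x))
    simp_rw [norm_mul (hermiteCoef α f)]
    rw [integral_const_mul]
    calc _ ≤ ‖hermiteCoef α f‖ * (C * (n * hermiteBound α) *
          ∫ x : EuclideanSpace ℝ (Fin n), regularWeight x) :=
          mul_le_mul_of_nonneg_left
            (integral_norm_mul_regularize_le hC (hb1 α) (hb2 α)) (norm_nonneg _)
      _ = _ := by ring)
  -- Inside the unit ball the expansion is used at both `x` and the origin, since regularization
  -- subtracts `f 0`.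
  have hpt (x : EuclideanSpace ℝ (Fin n)) : ∑' α : Fin n → ℕ, hermiteCoef α f *
      (singularKernel K x * regularize (fun x => (hermiteFun α x : ℂ)) x) =
      singularKernel K x * regularize f x := by
    refine HasSum.tsum_eq ?_
    have hx := hasSum_hermiteCoef_mul_hermiteFun f x
    have h0 := hasSum_hermiteCoef_mul_hermiteFun f 0
    by_cases h : ‖x‖ ≤ 1
    · simp only [regularize, h, if_true]
      refine ((hx.sub h0).mul_left (singularKernel K x)).congr_fun fun α => ?_
      ring
    · simp only [regularize, h, if_false, sub_zero]
      refine (hx.mul_left (singularKernel K x)).congr_fun fun α => ?_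
      ring
  simp_rw [hpt, integral_const_mul] at hs
  simp_rw [hK.principalValue_apply, pvIntegral, hreg]
  exact hs

end PrincipalValue

/-! ### Computation of the coefficients -/

/-- The monomial `x^β` times the Gaussian, as a Schwartz function. -/
noncomputable def monomialGaussian (β : Fin n → ℕ) : 𝓢(EuclideanSpace ℝ (Fin n), ℂ) :=
  polyGaussian fun i => Polynomial.X ^ β i

theorem monomialGaussian_apply (β : Fin n → ℕ) (x : EuclideanSpace ℝ (Fin n)) :
    monomialGaussian β x = (((∏ i, x i ^ β i) * Real.exp (-‖x‖ ^ 2 / 2) : ℝ) : ℂ) := by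
  simp [monomialGaussian, polyGaussian_apply]

theorem filter_Iic_eq_piFinset (α : Fin n → ℕ) :
    (Finset.Iic α).filter (fun γ => ∀ i, 2 * γ i ≤ α i) =
      Fintype.piFinset fun i => (Finset.range (α i + 1)).filter fun m => 2 * m ≤ α i := by
  ext γ
  simp only [Finset.mem_filter, Finset.mem_Iic, Fintype.mem_piFinset, Finset.mem_range, Pi.le_def]
  constructor
  · intro h i
    exact ⟨Nat.lt_succ_of_le (h.1 i), h.2 i⟩
  · intro h
    exact ⟨fun i => Nat.le_of_lt_succ (h i).1, fun i => (h i).2⟩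

theorem order_eq_add {α γ : Fin n → ℕ} (h : ∀ i, 2 * γ i ≤ α i) :
    order α = order (α - 2 • γ) + 2 * order γ := by
  rw [order, order, order, Finset.mul_sum, ← Finset.sum_add_distrib]
  refine Finset.sum_congr rfl fun i _ => ?_
  have := h i
  simp
  omega

theorem prod_hermitePoly_eq_sum (α : Fin n → ℕ) (x : EuclideanSpace ℝ (Fin n)) :
    ∏ i, (hermitePoly (α i)).eval (x i) = (factorial α : ℝ) *
      ∑ γ ∈ (Finset.Iic α).filter (fun γ => ∀ i, 2 * γ i ≤ α i),
        (-1 : ℝ) ^ order γ * 2 ^ order (α - 2 • γ) /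
          (factorial γ * factorial (α - 2 • γ)) * ∏ i, x i ^ (α - 2 • γ) i := by
  simp_rw [eval_hermitePoly_eq_sum]
  rw [Finset.prod_mul_distrib, Finset.prod_univ_sum, ← filter_Iic_eq_piFinset, factorial]
  push_cast
  congr 1
  refine Finset.sum_congr rfl fun γ _ => ?_
  simp_rw [mul_pow]
  rw [Finset.prod_mul_distrib, Finset.prod_mul_distrib, Finset.prod_div_distrib,
    Finset.prod_mul_distrib, Finset.prod_pow_eq_pow_sum, Finset.prod_pow_eq_pow_sum]
  simp only [order, factorial, Pi.sub_apply, Pi.smul_apply, smul_eq_mul]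
  push_cast
  ring

theorem hermiteSchwartz_eq_sum (α : Fin n → ℕ) :
    hermiteSchwartz α = ∑ γ ∈ (Finset.Iic α).filter (fun γ => ∀ i, 2 * γ i ≤ α i),
      (((∏ i, hermiteConst (α i)) * (factorial α * ((-1 : ℝ) ^ order γ * 2 ^ order (α - 2 • γ) /
          (factorial γ * factorial (α - 2 • γ)))) : ℝ) : ℂ) • monomialGaussian (α - 2 • γ) := by
  ext x
  rw [sum_apply]
  simp_rw [smul_apply, monomialGaussian_apply, smul_eq_mul, ← Complex.ofReal_mul]
  rw [← Complex.ofReal_sum, hermiteSchwartz, polyGaussian_apply]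
  congr 1
  simp_rw [Polynomial.eval_mul, Polynomial.eval_C]
  rw [Finset.prod_mul_distrib, prod_hermitePoly_eq_sum, Finset.mul_sum, Finset.mul_sum,
    Finset.sum_mul]
  exact Finset.sum_congr rfl fun γ _ => by ring

theorem order_pos {β : Fin n → ℕ} (hβ : β ≠ 0) : 0 < order β := by
  obtain ⟨i, hi⟩ := Function.ne_iff.1 hβ
  exact Finset.sum_pos' (fun _ _ => Nat.zero_le _) ⟨i, Finset.mem_univ i, Nat.pos_of_ne_zero hi⟩

theorem integral_pow_mul_exp_neg_sq_half {m : ℕ} (hm : 0 < m) :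
    ∫ r in Set.Ioi (0 : ℝ), r ^ (m - 1) * Real.exp (-r ^ 2 / 2) =
      2 ^ ((m : ℝ) / 2 - 1) * Real.Gamma ((m : ℝ) / 2) := by
  have h := integral_rpow_mul_exp_neg_mul_rpow (p := 2) (q := ((m - 1 : ℕ) : ℝ)) (b := 1 / 2)
    two_pos (by
      have : (0 : ℝ) ≤ ((m - 1 : ℕ) : ℝ) := Nat.cast_nonneg _
      linarith) (by norm_num)
  have hm1 : ((m - 1 : ℕ) : ℝ) + 1 = m := by
    rw [Nat.cast_sub hm]; simp
  rw [hm1] at h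
  calc _ = ∫ x in Set.Ioi (0 : ℝ), x ^ ((m - 1 : ℕ) : ℝ) * Real.exp (-(1 / 2) * x ^ (2 : ℝ)) := by
        refine setIntegral_congr_fun measurableSet_Ioi fun r _ => ?_
        rw [Real.rpow_natCast, Real.rpow_two]
        ring_nf
    _ = _ := by
        rw [h, Real.rpow_sub two_pos, Real.rpow_one, one_div, Real.inv_rpow two_pos.le, neg_div,
          Real.rpow_neg two_pos.le, inv_inv]
        ring

/-- The powers of two match because `|α| = |α - 2γ| + 2|γ|`: with `β = α - 2γ`, `-|α|/2 + |β| +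
|β|/2 - 1 = |α| - 1 - 3|γ|`. -/
theorem coefficient_identity {α γ : Fin n → ℕ} (h : ∀ i, 2 * γ i ≤ α i) :
    (∏ i, hermiteConst (α i)) * (factorial α * ((-1 : ℝ) ^ order γ * 2 ^ order (α - 2 • γ) /
      (factorial γ * factorial (α - 2 • γ)))) *
      (2 ^ ((order (α - 2 • γ) : ℝ) / 2 - 1) * Real.Gamma ((order (α - 2 • γ) : ℝ) / 2)) =
    Real.pi ^ (-(n : ℝ) / 4) * 2 ^ ((order α : ℝ) - 1) * √(factorial α) *
      (Real.Gamma ((order (α - 2 • γ) : ℝ) / 2) / (factorial γ * factorial (α - 2 • γ)) *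
        ((-1) ^ order γ / 2 ^ (3 * order γ))) := by
  have hfac : √(factorial α : ℝ) ≠ 0 := by
    have : 0 < factorial α := Finset.prod_pos fun i _ => Nat.factorial_pos _
    positivity
  have hsq : √(factorial α : ℝ) * √(factorial α) = factorial α :=
    Real.mul_self_sqrt (Nat.cast_nonneg _)
  have hpow : (2 : ℝ) ^ (-((order α : ℝ) / 2)) * 2 ^ order (α - 2 • γ) *
      2 ^ ((order (α - 2 • γ) : ℝ) / 2 - 1) = 2 ^ ((order α : ℝ) - 1) * (2 ^ (3 * order γ))⁻¹ := by
    have ho : (order α : ℝ) = order (α - 2 • γ) + 2 * order γ := by exact_mod_cast order_eq_add h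
    rw [← Real.rpow_natCast, ← Real.rpow_natCast, ← Real.rpow_add two_pos,
      ← Real.rpow_add two_pos, ← Real.rpow_neg two_pos.le, ← Real.rpow_add two_pos]
    congr 1
    rw [ho]
    push_cast
    ring
  rw [prod_hermiteConst, mul_inv, mul_inv, ← Real.rpow_neg Real.pi_pos.le,
    ← Real.rpow_neg two_pos.le, ← neg_div]
  have hinv : (√(factorial α : ℝ))⁻¹ * factorial α = √(factorial α) := by
    rw [inv_mul_eq_iff_eq_mul₀ hfac, hsq]
  calc _ = Real.pi ^ (-(n : ℝ) / 4) *
        ((√(factorial α : ℝ))⁻¹ * factorial α) *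
        (2 ^ (-((order α : ℝ) / 2)) * 2 ^ order (α - 2 • γ) *
          2 ^ ((order (α - 2 • γ) : ℝ) / 2 - 1)) *
        (Real.Gamma ((order (α - 2 • γ) : ℝ) / 2) / (factorial γ * factorial (α - 2 • γ)) *
          (-1) ^ order γ) := by ring
    _ = _ := by
        rw [hinv, hpow]
        ring

section Coefficients

variable [Nontrivial (EuclideanSpace ℝ (Fin n))] {K : EuclideanSpace ℝ (Fin n) → ℂ}

/-- The Gaussian stays radial after regularization, so the mean-zero condition kills it. -/
theorem IsMeanZeroKernel.principalValue_monomialGaussian_zero (hK : IsMeanZeroKernel K) :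
    hK.principalValue (monomialGaussian 0) = 0 := by
  classical
  rw [hK.principalValue_apply, pvIntegral, ← hK.integral_mul_radial fun r =>
    ((Real.exp (-r ^ 2 / 2) : ℝ) : ℂ) - if r ≤ 1 then 1 else 0]
  refine integral_congr_ae (ae_of_all _ fun x => ?_)
  simp [regularize, monomialGaussian_apply]

/-- For `β ≠ 0` the function vanishes at the origin, so nothing is subtracted. The radial integrand
is `r^(|β|-1) e^{-r²/2}`, integrable at `0` because `|β| > 0`. -/
theorem IsMeanZeroKernel.principalValue_monomialGaussian (hK : IsMeanZeroKernel K)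
    {β : Fin n → ℕ} (hβ : β ≠ 0) : hK.principalValue (monomialGaussian β) =
      ((2 ^ ((order β : ℝ) / 2 - 1) * Real.Gamma ((order β : ℝ) / 2) : ℝ) : ℂ) *
        sphereMoment n K β := by
  have hm := order_pos hβ
  have h0 : monomialGaussian β 0 = 0 := by
    obtain ⟨i, hi⟩ := Function.ne_iff.1 hβ
    have hi : β i ≠ 0 := hi
    rw [monomialGaussian_apply, Finset.prod_eq_zero (Finset.mem_univ i) (by simp [hi])]
    simp
  have hn : 0 < n := by
    have := Module.finrank_pos (R := ℝ) (M := EuclideanSpace ℝ (Fin n))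
    rwa [finrank_euclideanSpace_fin] at this
  rw [hK.principalValue_apply, pvIntegral, integral_eq_sphere_mul_radial _
    (fun x => ((∏ i, x i ^ β i : ℝ) : ℂ) * K x)
    (fun r => ((r ^ order β * Real.exp (-r ^ 2 / 2) : ℝ) : ℂ) / (r : ℂ) ^ n) fun x hx => ?_]
  · rw [mul_comm, ← sphereMoment, ← integral_pow_mul_exp_neg_sq_half hm, ← integral_complex_ofReal]
    congr 1
    refine setIntegral_congr_fun measurableSet_Ioi fun r hr => ?_
    have hr : (r : ℂ) ≠ 0 := Complex.ofReal_ne_zero.2 (ne_of_gt hr)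
    obtain ⟨k, rfl⟩ := Nat.exists_eq_add_of_le' hn
    obtain ⟨m, hm⟩ := Nat.exists_eq_add_of_le' hm
    simp only [hm, Nat.add_sub_cancel]
    push_cast
    field_simp
    ring
  · have hx0 := norm_ne_zero_iff.2 hx
    have hprod : ∏ i, (‖x‖⁻¹ • x) i ^ β i = (‖x‖ ^ order β)⁻¹ * ∏ i, x i ^ β i := by
      simp only [PiLp.smul_apply, smul_eq_mul, mul_pow]
      rw [Finset.prod_mul_distrib, Finset.prod_pow_eq_pow_sum, ← order, inv_pow]
    rw [hK.map_inv_norm_smul hx, hprod, regularize, h0, ite_self, sub_zero,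
      monomialGaussian_apply, singularKernel]
    push_cast
    have hx1 : (‖x‖ : ℂ) ≠ 0 := Complex.ofReal_ne_zero.2 hx0
    field_simp

/-- The Hermite coefficients of the principal value distribution. -/
theorem IsMeanZeroKernel.principalValue_hermiteSchwartz (hK : IsMeanZeroKernel K)
    (α : Fin n → ℕ) :
    hK.principalValue (hermiteSchwartz α) =
      ((Real.pi ^ (-(n : ℝ) / 4) * 2 ^ ((order α : ℝ) - 1) * √(factorial α) : ℝ) : ℂ) *
        ∑ γ ∈ (Finset.Iic α).filter (fun γ => (∀ i, 2 * γ i ≤ α i) ∧ 2 • γ ≠ α),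
          ((Real.Gamma ((order (α - 2 • γ) : ℝ) / 2) / (factorial γ * factorial (α - 2 • γ)) *
            ((-1) ^ order γ / 2 ^ (3 * order γ)) : ℝ) : ℂ) * sphereMoment n K (α - 2 • γ) := by
  rw [hermiteSchwartz_eq_sum, map_sum, Finset.mul_sum]
  have hfilter : (Finset.Iic α).filter (fun γ => (∀ i, 2 * γ i ≤ α i) ∧ 2 • γ ≠ α) =
      ((Finset.Iic α).filter fun γ => ∀ i, 2 * γ i ≤ α i).filter fun γ => 2 • γ ≠ α := by
    rw [Finset.filter_filter]
  rw [hfilter, Finset.sum_filter (fun γ => 2 • γ ≠ α)]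
  refine Finset.sum_congr rfl fun γ hγ => ?_
  have hγ := (Finset.mem_filter.1 hγ).2
  rw [map_smul, smul_eq_mul]
  -- Terms with `2γ ≠ α` give a spherical moment; the one with `2γ = α`, if it occurs, is the radial
  -- Gaussian and gives zero.
  split_ifs with h
  · have hne : α - 2 • γ ≠ 0 := by
      intro h0
      refine h (funext fun i => ?_)
      have h1 : α i - 2 * γ i = 0 := by simpa using congrFun h0 i
      have := hγ i
      simp
      omega
    rw [hK.principalValue_monomialGaussian hne, ← mul_assoc, ← Complex.ofReal_mul,
      coefficient_identity hγ, Complex.ofReal_mul, mul_assoc]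
  · have h0 : α - 2 • γ = 0 := by
      rw [not_not.1 h]; simp
    rw [h0, hK.principalValue_monomialGaussian_zero, mul_zero]

end Coefficients

/-! ### Uniqueness and conclusion -/

/-- Test the expansion against `h_β`, itself a Schwartz function: orthonormality leaves a single
term. -/
theorem hasHermiteExpansion_unique {T : 𝓢'(EuclideanSpace ℝ (Fin n), ℂ)} {a : (Fin n → ℕ) → ℂ}
    (h : HasHermiteExpansion T a) (β : Fin n → ℕ) : a β = T (hermiteSchwartz β) := by
  have hs := h (hermiteSchwartz β)
  have hval (α : Fin n → ℕ) : a α * ∫ x, (hermiteFun α x : ℂ) * hermiteSchwartz β x =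
      if α = β then a β else 0 := by
    simp_rw [hermiteSchwartz_apply]
    rw [← hermiteCoef, hermiteCoef_hermiteFun]
    by_cases hαβ : α = β
    · subst hαβ; simp
    · simp [hαβ]
  simp_rw [hval] at hs
  exact (hasSum_ite_eq β (a β)).unique hs

end HermiteExpansion

theorem theorem4p3 (n : ℕ) (hn : 2 ≤ n) (K : EuclideanSpace ℝ (Fin n) → ℂ)
    (hK_smooth : ContDiffOn ℝ ∞ K {0}ᶜ)
    (hK_hom : ∀ (r : ℝ) (x : EuclideanSpace ℝ (Fin n)), 0 < r → x ≠ 0 → K (r • x) = K x)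
    (hK_mean : ∫ u : Metric.sphere (0 : EuclideanSpace ℝ (Fin n)) 1, K u
      ∂(volume : Measure (EuclideanSpace ℝ (Fin n))).toSphere = 0) :
    ∃ T : 𝓢'(EuclideanSpace ℝ (Fin n), ℂ),
      HermiteExpansion.IsPrincipalValue K T ∧
      ∀ a : (Fin n → ℕ) → ℂ,
        HermiteExpansion.HasHermiteExpansion T a ↔
          (a 0 = 0 ∧
            ∀ α : Fin n → ℕ, α ≠ 0 →
              a α =
                ((Real.pi ^ (-(n : ℝ) / 4) * 2 ^ ((HermiteExpansion.order α : ℝ) - 1) *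
                    Real.sqrt (HermiteExpansion.factorial α) : ℝ) : ℂ) *
                  ∑ γ ∈ (Finset.Iic α).filter (fun γ => (∀ i, 2 * γ i ≤ α i) ∧ 2 • γ ≠ α),
                    ((Real.Gamma ((HermiteExpansion.order (α - 2 • γ) : ℝ) / 2) /
                        (HermiteExpansion.factorial γ *
                          HermiteExpansion.factorial (α - 2 • γ)) *
                        ((-1) ^ HermiteExpansion.order γ /
                          2 ^ (3 * HermiteExpansion.order γ)) : ℝ) : ℂ) *
                      HermiteExpansion.sphereMoment n K (α - 2 • γ)) := by
  have hK : HermiteExpansion.IsMeanZeroKernel K := ⟨hK_smooth.continuousOn, hK_hom, hK_mean⟩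
  have : Nontrivial (EuclideanSpace ℝ (Fin n)) := by
    refine Module.nontrivial_of_finrank_pos (R := ℝ) ?_
    rw [finrank_euclideanSpace_fin]
    omega
  refine ⟨hK.principalValue, hK.isPrincipalValue, fun a => ?_⟩
  -- For `α = 0` the only candidate is `γ = 0`, excluded by `2γ ≠ α`, so the sum is empty.
  have hzero : hK.principalValue (HermiteExpansion.hermiteSchwartz 0) = 0 := by
    rw [hK.principalValue_hermiteSchwartz, Finset.sum_eq_zero, mul_zero]
    intro γ hγ
    obtain ⟨h1, -, h2⟩ := Finset.mem_filter.1 hγ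
    have : γ = 0 := le_antisymm (Finset.mem_Iic.1 h1) (fun _ => Nat.zero_le _)
    simp [this] at h2
  constructor
  · intro h
    refine ⟨(HermiteExpansion.hasHermiteExpansion_unique h 0).trans hzero, fun α _ => ?_⟩
    rw [HermiteExpansion.hasHermiteExpansion_unique h α, hK.principalValue_hermiteSchwartz]
  · rintro ⟨h0, h1⟩ f
    refine (hK.hasSum_hermiteCoef_mul_pvIntegral f).congr_fun fun α => ?_
    rw [mul_comm, HermiteExpansion.hermiteCoef]
    congr 1
    by_cases hα : α = 0
    · rw [hα, h0, hzero]
    · rw [h1 α hα, hK.principalValue_hermiteSchwartz]
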